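/- **Setting.** Let $G$ be a group. A *family* of subgroups of $G$ is a non-empty collection $\mathcal F$ of subgroups closed under conjugation and under passing to subgroups; for $H\le G$ put $\mathcal F\cap H=\{K\cap H: K\in\mathcal F\}$, a family of subgroups of $H$. A *$G$-complex* is a CW complex on which $G$ acts by homeomorphisms permuting the open cells, such that a cell fixed setwise is fixed pointwise; it is *cocompact* if it has finitely many $G$-orbits of cells. A *model for $E_{\mathcal F}G$* is a $G$-complex $X$ all of whose isotropy groups lie in $\mathcal F$ and whose fixed point set $X^K$ is non-empty and contractible for every $K\in\mathcal F$. The *orbit category* $\mathcal O_{\mathcal F}(G)$ has objects the $G$-sets $G/K$, $K\in\mathcal F$, and morphisms the $G$-maps; an $\mathcal O_{\mathcal F}(G)$-module is a contravariant functor from it to abelian groups, and $\mathbb Z_{G,\mathcal F}$ is the constant module $\mathbb Z$. One writes $\mathrm{cd}_{\mathcal F}(G)\le n$ if there is a projective resolution $0\to P_n\to\dots\to P_0\to\mathbb Z_{G,\mathcal F}\to 0$, and $G$ is of type $FP_{n,\mathcal F}$ if $\mathbb Z_{G,\mathcal F}$ has a projective resolution $P_*$ with $P_i$ finitely generated for $i\le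 n$ (an $FP_{n,\mathcal F}$-resolution). A *filling norm* on a finitely generated $\mathbb ZG$-module $M$ is $\|m\|=\min\{\|x\|_1: \eta(x)=m\}$, where $\eta$ is a surjective homomorphism onto $M$ from a finitely generated free $\mathbb ZG$-module with a chosen basis $B$ and $\|\cdot\|_1$ is the $\ell_1$-norm with respect to the $\mathbb Z$-basis $\{gb: g\in G,\ b\in B\}$. If $G$ is of type $FP_{2,\mathcal F}$, choose an $FP_{2,\mathcal F}$-resolution, evaluate it at $G/1$ to get $P_2\xrightarrow{\partial_2}P_1\xrightarrow{\partial_1}P_0$, choose filling norms on $P_1$ and $P_2$, and set $\|\gamma\|_{\partial_2}=\min\{\|\mu\|_{P_2}:\partial_2\mu=\gamma\}$ and $$FV_{G,\mathcal F}(k)=\sup\{\|\gamma\|_{\partial_2}:\gamma\in\ker\partial_1,\ \|\gamma\|_{P_1}\le k\}\in\mathbb N\cup\{\infty\}.$$ For $f,g:\mathbb N\to\mathbb N\cup\{\infty\}$ write $f\preceq g$ if there is an integer $C>0$ with $f(n)\le C\,g(Cn+C)+Cn+C$ for all $n\in\mathbb N$. **Theorem.** Let $G$ be a group and $\mathcal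 F$ a family of subgroups of $G$. Suppose that $G$ admits a cocompact model for $E_{\mathcal F}G$ and that $\mathrm{cd}_{\mathcal F}(G)\le 2$. Let $H\le G$ be a subgroup of type $FP_{2,\mathcal F\cap H}$. Then $G$ is of type $FP_{2,\mathcal F}$, so that $FV_{G,\mathcal F}$ is defined, and $$FV_{H,\mathcal F\cap H}\preceq FV_{G,\mathcal F}$$ for all choices of resolutions and filling norms used to define the two functions. -/

import Mathlib

open CategoryTheory Topology

universe u

/-- A family of subgroups of `G`: a non-empty collection of subgroups closed under conjugation
and under passing to subgroups. -/
structure SubgroupFamily (G : Type u) [Group G] where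
  carrier : Set (Subgroup G)
  nonempty' : carrier.Nonempty
  conj_mem' : ∀ K ∈ carrier, ∀ g : G, K.map (MulAut.conj g).toMonoidHom ∈ carrier
  le_mem' : ∀ K ∈ carrier, ∀ L : Subgroup G, L ≤ K → L ∈ carrier

namespace SubgroupFamily

variable {G : Type u} [Group G]

instance : Membership (Subgroup G) (SubgroupFamily G) := ⟨fun F K => K ∈ F.carrier⟩

theorem bot_mem (F : SubgroupFamily G) : (⊥ : Subgroup G) ∈ F := by
  obtain ⟨K, hK⟩ := F.nonempty'
  exact F.le_mem' K hK ⊥ bot_le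

/-- The family `F ∩ H = {K ∩ H : K ∈ F}` of subgroups of `H`. -/
def inter (F : SubgroupFamily G) (H : Subgroup G) : SubgroupFamily H where
  carrier := {L | ∃ K ∈ F, L = K.subgroupOf H}
  nonempty' := ⟨_, ⊥, F.bot_mem, rfl⟩
  conj_mem' := by
    rintro _ ⟨K, hK, rfl⟩ g
    refine ⟨_, F.conj_mem' K hK (g : G), ?_⟩
    ext x
    simp only [Subgroup.mem_map, Subgroup.mem_subgroupOf, MulEquiv.coe_toMonoidHom,
      MulAut.conj_apply]
    constructor
    · rintro ⟨y, hy, rfl⟩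
      exact ⟨y, hy, by simp⟩
    · rintro ⟨y, hy, hyx⟩
      have hyH : y ∈ H := by
        have : y = (g : G)⁻¹ * x * g := by rw [← hyx]; group
        rw [this]
        exact H.mul_mem (H.mul_mem (H.inv_mem g.2) x.2) g.2
      exact ⟨⟨y, hyH⟩, hy, Subtype.ext hyx⟩
  le_mem' := by
    rintro _ ⟨K, hK, rfl⟩ L hL
    refine ⟨L.map H.subtype, F.le_mem' K hK _ ?_, ?_⟩
    · rintro _ ⟨x, hx, rfl⟩
      exact hL hx
    · exact (Subgroup.comap_map_eq_self_of_injective H.subtype_injective L).symm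

end SubgroupFamily

/-! ### Complexes with a group action and cocompact models for the classifying space -/

section Complexes

open Topology.RelCWComplex

/-- `X` is a `G`-complex: a CW complex on which `G` acts by continuous maps permuting the open
cells of each dimension, without inversions (a cell that is fixed setwise is fixed pointwise). -/
structure IsGComplex (G : Type u) [Group G] (X : Type u) [TopologicalSpace X] [MulAction G X]
    [CWComplex (Set.univ : Set X)] : Prop where
  continuous_smul : ∀ g : G, Continuous fun x : X => g • x
  smul_openCell : ∀ (g : G) (n : ℕ) (i : cell (Set.univ : Set X) n),
    ∃ j : cell (Set.univ : Set X) n, (fun x : X => g • x) '' openCell n i = openCell n j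
  no_inversion : ∀ (g : G) (n : ℕ) (i : cell (Set.univ : Set X) n),
    (fun x : X => g • x) '' openCell n i = openCell n i → ∀ x ∈ openCell n i, g • x = x

/-- There are finitely many orbits of cells (of all dimensions together). -/
def IsCocompactGComplex (G : Type u) [Group G] (X : Type u) [TopologicalSpace X] [MulAction G X]
    [CWComplex (Set.univ : Set X)] : Prop :=
  ∃ T : Finset (Σ n : ℕ, cell (Set.univ : Set X) n),
    ∀ (n : ℕ) (i : cell (Set.univ : Set X) n), ∃ (g : G) (j : cell (Set.univ : Set X) n),
      (⟨n, j⟩ : Σ n : ℕ, cell (Set.univ : Set X) n) ∈ T ∧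
        (fun x : X => g • x) '' openCell n j = openCell n i

/-- `X` is a model for `E_F G`: a `G`-complex whose isotropy groups all belong to `F` and such that
the fixed point set `X^K` is (non-empty and) contractible for every `K ∈ F`. -/
structure IsClassifyingModel {G : Type u} [Group G] (F : SubgroupFamily G) (X : Type u)
    [TopologicalSpace X] [MulAction G X] [CWComplex (Set.univ : Set X)] : Prop where
  isGComplex : IsGComplex G X
  stabilizer_mem : ∀ x : X, MulAction.stabilizer G x ∈ F
  contractible_fixedPoints : ∀ K ∈ F, ContractibleSpace (MulAction.fixedPoints K X)

/-- `G` admits a cocompact model for `E_F G`. -/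
def HasCocompactModel {G : Type u} [Group G] (F : SubgroupFamily G) : Prop :=
  ∃ (X : Type u) (_ : TopologicalSpace X) (_ : T2Space X) (_ : MulAction G X)
    (_ : CWComplex (Set.univ : Set X)), IsClassifyingModel F X ∧ IsCocompactGComplex G X

end Complexes

/-! ### Modules over the orbit category -/

/-- The orbit category `O_F(G)`; the object with subgroup `K ∈ F` stands for the `G`-set `G/K`. -/
structure OrbitCategory {G : Type u} [Group G] (F : SubgroupFamily G) : Type u where
  subgroup : Subgroup G
  mem : subgroup ∈ F

namespace OrbitCategory

variable {G : Type u} [Group G] {F : SubgroupFamily G}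

/-- Morphisms `G/K ⟶ G/L` are the `G`-maps. -/
instance : Category.{u} (OrbitCategory F) where
  Hom A B := (G ⧸ A.subgroup) →[G] (G ⧸ B.subgroup)
  id A := MulActionHom.id G
  comp f g := g.comp f

variable (F) in
/-- The object `G/1`. -/
def base : OrbitCategory F := ⟨⊥, F.bot_mem⟩

/-- The `G`-map `G/1 ⟶ G/1` sending the trivial coset to the coset of `g`. -/
def rightMul (g : G) : base F ⟶ base F where
  toFun := Quotient.map' (fun x : G => x * g) (by
    intro x y h
    rw [QuotientGroup.leftRel_apply] at h ⊢
    have h' : x⁻¹ * y = 1 := h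
    have hxy : x = y := inv_mul_eq_one.mp h'
    subst hxy
    simp)
  map_smul' a x := by
    induction x using QuotientGroup.induction_on with
    | H x => exact congrArg (QuotientGroup.mk) (mul_assoc a x g)

theorem rightMul_one : rightMul (F := F) (1 : G) = 𝟙 (base F) := by
  refine MulActionHom.ext fun x => ?_
  induction x using QuotientGroup.induction_on with
  | H x => exact congrArg (QuotientGroup.mk) (mul_one x)

theorem rightMul_comp (g h : G) :
    rightMul (F := F) g ≫ rightMul h = rightMul (g * h) := by
  refine MulActionHom.ext fun x => ?_
  induction x using QuotientGroup.induction_on with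
  | H x => exact congrArg (QuotientGroup.mk) (mul_assoc x g h)

end OrbitCategory

/-- (Right) modules over `O_F(G)`: contravariant functors to abelian groups, with natural
transformations as morphisms. -/
abbrev BredonModule {G : Type u} [Group G] (F : SubgroupFamily G) :=
  (OrbitCategory F)ᵒᵖ ⥤ AddCommGrpCat.{u}

namespace BredonModule

variable {G : Type u} [Group G] {F : SubgroupFamily G}

variable (F) in
/-- The module `ℤ_{G,F}` with all components `ℤ` and all structure maps the identity. -/
def trivialZ : BredonModule F :=
  (Functor.const (OrbitCategory F)ᵒᵖ).obj (AddCommGrpCat.of (ULift.{u} ℤ))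

/-- `M` is finitely generated: finitely many elements `x i ∈ M[G/K i]` exist such that every
component of `M` is generated by their images under the structure maps. -/
def IsFinitelyGenerated (M : BredonModule F) : Prop :=
  ∃ (n : ℕ) (A : Fin n → OrbitCategory F) (x : ∀ i, M.obj (Opposite.op (A i))),
    ∀ B : OrbitCategory F,
      AddSubgroup.closure
        {y : M.obj (Opposite.op B) | ∃ (i : Fin n) (φ : B ⟶ A i), y = M.map φ.op (x i)} = ⊤

/-- The component `M[G/1]`. -/
abbrev component (M : BredonModule F) : Type u := M.obj (Opposite.op (OrbitCategory.base F))

/-- The left `G`-action making `M[G/1]` a `ℤG`-module: `g` acts by the structure map of the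
`G`-map `G/1 ⟶ G/1` sending the trivial coset to the coset of `g`. -/
instance (M : BredonModule F) : DistribMulAction G M.component where
  smul g m := M.map (OrbitCategory.rightMul g).op m
  one_smul m := by
    change M.map (OrbitCategory.rightMul 1).op m = m
    rw [OrbitCategory.rightMul_one]
    simp
  mul_smul g h m := by
    change M.map (OrbitCategory.rightMul (g * h)).op m =
      M.map (OrbitCategory.rightMul g).op (M.map (OrbitCategory.rightMul h).op m)
    rw [← OrbitCategory.rightMul_comp]
    simp
  smul_zero g := map_zero (M.map (OrbitCategory.rightMul g).op).hom
  smul_add g := map_add (M.map (OrbitCategory.rightMul g).op).hom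

end BredonModule

open BredonModule in
/-- `P` is an `FP_{n,F}`-resolution: a projective resolution of `ℤ_{G,F}` whose modules in degrees
`0, …, n` are finitely generated. -/
def IsFPResolution {G : Type u} [Group G] {F : SubgroupFamily G} (n : ℕ)
    (P : ProjectiveResolution (trivialZ F)) : Prop :=
  ∀ i ≤ n, (show BredonModule F from P.complex.X i).IsFinitelyGenerated

open BredonModule in
/-- `G` is of type `FP_{n,F}`. -/
def IsTypeFP {G : Type u} [Group G] (n : ℕ) (F : SubgroupFamily G) : Prop :=
  ∃ P : ProjectiveResolution (trivialZ F), IsFPResolution n P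

open BredonModule in
/-- The Bredon cohomological dimension of `G` relative to `F` is at most `n`: there is a projective
resolution `0 → P_n → ⋯ → P_0 → ℤ_{G,F} → 0`. -/
def BredonCohomDimLE {G : Type u} [Group G] (F : SubgroupFamily G) (n : ℕ) : Prop :=
  ∃ P : ProjectiveResolution (trivialZ F), ∀ i, n < i → Limits.IsZero (P.complex.X i)

/-! ### Filling norms and the homological filling function -/

section FillingNorm

variable {G : Type u} [Group G] {M : Type u} [AddCommGroup M] [DistribMulAction G M] {n : ℕ}

/-- The `ℓ₁`-norm on the based free `ℤG`-module of rank `n`, whose elements are written in the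
`ℤ`-basis `{g eᵢ}` indexed by `Fin n × G`. -/
def l1Norm (x : Fin n × G →₀ ℤ) : ℕ := x.sum fun _ c => c.natAbs

/-- The `ℤG`-homomorphism from the based free `ℤG`-module of rank `n` to `M` that sends the basis
element `eᵢ` to `b i`. -/
noncomputable def freeMap (b : Fin n → M) : (Fin n × G →₀ ℤ) →+ M :=
  Finsupp.liftAddHom fun p => (zmultiplesHom M) (p.2 • b p.1)

variable (G) in
/-- `b` generates `M` as a `ℤG`-module: the associated homomorphism is surjective. -/
def Generates (b : Fin n → M) : Prop := Function.Surjective (freeMap (G := G) b)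

variable (G) in
/-- The filling norm on `M` induced by the surjection `freeMap b`. -/
noncomputable def fillingNorm (b : Fin n → M) (m : M) : ℕ∞ :=
  ⨅ (x : Fin n × G →₀ ℤ) (_ : freeMap b x = m), (l1Norm x : ℕ∞)

end FillingNorm

section FillingFunction

open BredonModule

variable {G : Type u} [Group G] {F : SubgroupFamily G}

/-- The module `P_i[G/1]` of a resolution `P` of `ℤ_{G,F}`. -/
abbrev resolutionComponent (P : ProjectiveResolution (trivialZ F)) (i : ℕ) : Type u :=
  BredonModule.component (P.complex.X i)

/-- The component at `G/1` of the differential `∂_{i+1} : P_{i+1} → P_i`. -/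
def resolutionBoundary (P : ProjectiveResolution (trivialZ F)) (i : ℕ) :
    resolutionComponent P (i + 1) →+ resolutionComponent P i :=
  ((P.complex.d (i + 1) i).app (Opposite.op (OrbitCategory.base F))).hom

/-- `‖γ‖_{∂₂} = min {‖μ‖_{P₂} : ∂₂ μ = γ}`, for the filling norm on `P₂[G/1]` given by `b₂`. -/
noncomputable def boundaryNorm (P : ProjectiveResolution (trivialZ F)) {n₂ : ℕ}
    (b₂ : Fin n₂ → resolutionComponent P 2) (γ : resolutionComponent P 1) : ℕ∞ :=
  ⨅ (μ : resolutionComponent P 2) (_ : resolutionBoundary P 1 μ = γ), fillingNorm G b₂ μ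

/-- `k ↦ max {‖γ‖_{∂₂} : γ ∈ ker ∂₁, ‖γ‖_{P₁} ≤ k}`, with value `∞` if unbounded. -/
noncomputable def fillingFunction (P : ProjectiveResolution (trivialZ F)) {n₁ n₂ : ℕ}
    (b₁ : Fin n₁ → resolutionComponent P 1) (b₂ : Fin n₂ → resolutionComponent P 2) (k : ℕ) : ℕ∞ :=
  ⨆ (γ : resolutionComponent P 1) (_ : resolutionBoundary P 0 γ = 0)
    (_ : fillingNorm G b₁ γ ≤ k), boundaryNorm P b₂ γ

/-- `f` is (a representative of) the homological filling function `FV_{G,F}`, i.e. it is obtained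
from some choice of an `FP_{2,F}`-resolution and of filling norms on its modules at `G/1`. -/
def IsHomologicalFillingFunction (F : SubgroupFamily G) (f : ℕ → ℕ∞) : Prop :=
  ∃ (P : ProjectiveResolution (trivialZ F)) (_ : IsFPResolution 2 P)
    (n₁ n₂ : ℕ) (b₁ : Fin n₁ → resolutionComponent P 1) (b₂ : Fin n₂ → resolutionComponent P 2),
    Generates G b₁ ∧ Generates G b₂ ∧ f = fillingFunction P b₁ b₂

end FillingFunction

/-- `f ⪯ g`: there is `0 < C < ∞` with `f n ≤ C g(C n + C) + C n + C` for all `n`. -/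
def GrowthLE (f g : ℕ → ℕ∞) : Prop :=
  ∃ C : ℕ, 0 < C ∧ ∀ n : ℕ, f n ≤ (C : ℕ∞) * g (C * n + C) + (C * n + C : ℕ)

/-! The filling inequality rests on uniqueness of fillings. Let P' be a projective resolution of
length two for G. Its ∂₂ is injective, so a 1-cycle has at most one filling in P'. Let Q and P be
the resolutions defining the filling functions of H and G. Restriction to H is exact and preserves
projectives, so there are chain maps α : Q → P, β : P → P' and δ : P' → Q over H, with β already
defined over G and δβα homotopic to the identity through some η. Given a cycle γ in Q, choose a
cheap filling μ of αγ in P. For any filling ν of γ, uniqueness gives βαν = βμ, so δβμ - ηγ fills γ;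
this is `exists_comparison`. Its cost is to be bounded by ‖μ‖ and ‖γ‖.

Equivariant maps out of finitely generated modules are bounded, which handles α, β and η. The map δ
is only H-equivariant and P'₂ need not be finitely generated, so δ has no a priori bound. However,
P'₂ is a retract of a free module, and all chains βαν lie in the span of finitely many H-orbits of
basis elements, because Q₂ at H/1 is finitely generated over H. On that span δ is bounded
(`exists_bound_on_image`). `growthLE_of_bredonCohomDimLE` assembles the estimates, directly for
arbitrary resolutions and norms.

For type FP₂ of G, the open cells of a cocompact model, preordered by incidence with closures, have
finite lower sets, finitely many orbits and isotropy in F. Chains of one, two and three cells give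
finitely generated free modules. Exactness at G/K says that the K-fixed cells have only constant
0-cocycles and no H¹, for all coefficients. This follows from contractibility of X^K: stars of cells
are open and connected, so a 1-cocycle defines a covering of X^K, and a section of that covering is
a primitive (`exists_coboundary_of_contractibleSpace`). `isTypeFP_two_of_preorder` turns this into a
resolution. -/

/-! ### Cohomology of a preorder stratifying a contractible space -/

section Stratification

variable {Y P A : Type*} [TopologicalSpace Y] [Preorder P] {c : Y → P}

/-- A function on a preorder that is constant along comparable pairs is constant, if the preorder
stratifies a connected space with open stars. -/
theorem eq_of_le_imp_eq_of_isOpen_star [PreconnectedSpace Y] (hsurj : Function.Surjective c)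
    (hopen : ∀ p, IsOpen {y | p ≤ c y}) (v : P → A) (hv : ∀ p q, p ≤ q → v p = v q) (p q : P) :
    v p = v q := by
  obtain ⟨x, rfl⟩ := hsurj p
  obtain ⟨y, rfl⟩ := hsurj q
  -- On the open star of `c x`, the function `v ∘ c` takes only the value `v (c x)`.
  refine (IsLocallyConstant.iff_exists_open (v ∘ c)).2 (fun x => ?_) |>.apply_eq_of_preconnectedSpace x y
  exact ⟨_, hopen (c x), le_rfl, fun y hy => (hv _ _ hy).symm⟩

variable [AddCommGroup A]

/-- The principal bundle with discrete fibre `A` on a space stratified by a preorder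
that is attached to a one-cocycle on the preorder. -/
def cocycleBundleCore [TopologicalSpace A] [DiscreteTopology A]
    (hopen : ∀ p, IsOpen {y | p ≤ c y}) (α : P → P → A)
    (hα : ∀ p q r, p ≤ q → q ≤ r → α p q + α q r = α p r) : FiberBundleCore P Y A where
  baseSet p := {y | p ≤ c y}
  isOpen_baseSet := hopen
  indexAt := c
  mem_baseSet_at x := le_refl (c x)
  coordChange p q y a := a + (α p (c y) - α q (c y))
  coordChange_self p y _ a := by simp
  continuousOn_coordChange p q := by
    rintro ⟨y, a⟩ ⟨⟨hp, hq⟩, -⟩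
    refine ContinuousAt.continuousWithinAt ?_
    -- For `x` in the star of `c y`, the cocycle identity writes `α p (c x)` as `α p (c y) + α (c y)
    -- (c x)`. The last term cancels in the difference, so the transition function is locally
    -- constant.
    have h : (fun x : Y × A => x.2 + (α p (c x.1) - α q (c x.1))) =ᶠ[𝓝 (y, a)]
        fun x => x.2 + (α p (c y) - α q (c y)) := by
      have := (hopen (c y)).mem_nhds (le_refl (c y))
      filter_upwards [continuous_fst.continuousAt.preimage_mem_nhds this] with x hx
      rw [← hα p _ _ hp hx, ← hα q _ _ hq hx]
      abel
    refine ContinuousAt.congr ?_ h.symm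
    exact ((continuous_of_discreteTopology (f := fun t : A => t + (α p (c y) - α q (c y)))).comp
      continuous_snd).continuousAt
  coordChange_comp p q r y _ a := by abel

/-- A one-cocycle on a preorder that stratifies a contractible space with open connected stars
is a coboundary. -/
theorem exists_coboundary_of_contractibleSpace [ContractibleSpace Y]
    (hsurj : Function.Surjective c) (hopen : ∀ p, IsOpen {y | p ≤ c y})
    (hconn : ∀ p, IsPreconnected {y | p ≤ c y}) (α : P → P → A)
    (hα : ∀ p q r, p ≤ q → q ≤ r → α p q + α q r = α p r) :
    ∃ v : P → A, ∀ p q, p ≤ q → α p q = v q - v p := by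
  -- With discrete fibres the bundle is a covering.
  let _ : TopologicalSpace A := ⊥
  have : DiscreteTopology A := ⟨rfl⟩
  let Z := cocycleBundleCore hopen α hα
  have hcov : IsCoveringMap (Bundle.TotalSpace.proj : Bundle.TotalSpace A Z.Fiber → Y) :=
    FiberBundle.isCoveringMap
  -- A contraction, run from the constant map to the identity, lifts to the covering from a chosen
  -- point; the endpoint of the lift is a section.
  obtain ⟨s, hs, hs'⟩ : ∃ s : Y → Bundle.TotalSpace A Z.Fiber, Continuous s ∧ ∀ y, (s y).1 = y := by
    obtain ⟨y₀, ⟨h⟩⟩ := id_nullhomotopic Y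
    let H := h.symm
    let e : Bundle.TotalSpace A Z.Fiber := ⟨y₀, (0 : A)⟩
    let K := hcov.liftHomotopy H.toContinuousMap (ContinuousMap.const Y e)
      (fun y => H.apply_zero y)
    refine ⟨fun y => K (1, y), by fun_prop, fun y => ?_⟩
    have := congrFun (hcov.liftHomotopy_lifts H.toContinuousMap (ContinuousMap.const Y e)
      (fun y => H.apply_zero y)) (1, y)
    exact this.trans (H.apply_one y)
  -- In the chart `p` the section is a continuous map from a connected star to a discrete group. Its
  -- constant value is the primitive at `p`; comparing the charts `p` and `q` at a point of the
  -- stratum `q` gives the coboundary relation.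
  have key : ∀ p, ∃ a : A, ∀ y, p ≤ c y → (Z.localTriv p (s y)).2 = a := by
    intro p
    have hcont : ContinuousOn (fun y => (Z.localTriv p (s y)).2) {y | p ≤ c y} := by
      refine continuous_snd.comp_continuousOn
        ((Z.localTriv p).continuousOn.comp hs.continuousOn fun y hy => ?_)
      rw [Bundle.Trivialization.mem_source]
      rw [hs' y]
      exact hy
    obtain ⟨y₀, hy₀⟩ := hsurj p
    exact ⟨_, fun y hy => (hconn p).constant hcont hy hy₀.ge⟩
  choose v hv using key
  refine ⟨v, fun p q hpq => ?_⟩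
  obtain ⟨y, rfl⟩ := hsurj q
  have h1 := hv p y hpq
  have h2 := hv (c y) y le_rfl
  rw [← h1, ← h2, Z.localTriv_apply, Z.localTriv_apply]
  have hs1 : (s y).1 = y := hs' y
  let a : A := (s y).2
  change α p (c y) = (a + (α (c (s y).1) (c (s y).1) - α (c y) (c (s y).1))) -
    (a + (α (c (s y).1) (c (s y).1) - α p (c (s y).1)))
  rw [hs1]
  have h0 := hα (c y) (c y) (c y) le_rfl le_rfl
  rw [add_eq_right] at h0
  rw [h0]
  abel

end Stratification

/-! ### The preorder of open cells of a CW complex -/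

section Cells

open Topology.RelCWComplex

variable {G : Type u} [Group G] {X : Type u} [TopologicalSpace X] [CWComplex (Set.univ : Set X)]

variable (X) in
/-- The open cells of a CW complex, as subsets. -/
def OpenCells : Type u :=
  {U : Set X // ∃ (n : ℕ) (i : cell (Set.univ : Set X) n), U = openCell n i}

namespace OpenCells

/-- The preorder generated by the relation that a cell meets the closure of another one. -/
instance : Preorder (OpenCells X) where
  -- The closure of a cell need not be a union of cells, so meeting the closure is not itself
  -- transitive.
  le := Relation.ReflTransGen fun e f => (e.1 ∩ closure f.1).Nonempty
  le_refl _ := .refl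
  le_trans _ _ _ := .trans

theorem le_of_nonempty {e f : OpenCells X} (h : (e.1 ∩ closure f.1).Nonempty) : e ≤ f :=
  Relation.ReflTransGen.single h

theorem nonempty (e : OpenCells X) : e.1.Nonempty := by
  obtain ⟨_, n, i, rfl⟩ := e
  exact openCell_nonempty n i

theorem isPreconnected (e : OpenCells X) : IsPreconnected e.1 := by
  obtain ⟨_, n, i, rfl⟩ := e
  exact (convex_ball _ _).isPreconnected.image _
    ((continuousOn n i).mono Metric.ball_subset_closedBall)

theorem eq_of_mem {e f : OpenCells X} {x : X} (he : x ∈ e.1) (hf : x ∈ f.1) : e = f := by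
  obtain ⟨_, n, i, rfl⟩ := e
  obtain ⟨_, m, j, rfl⟩ := f
  have := eq_of_not_disjoint_openCell (Set.not_disjoint_iff.2 ⟨x, he, hf⟩)
  cases this
  rfl

theorem exists_mem (x : X) : ∃ e : OpenCells X, x ∈ e.1 := by
  have h : x ∈ ⋃ (n : ℕ) (j : cell (Set.univ : Set X) n), openCell n j := by
    rw [CWComplex.iUnion_openCell_eq_complex]
    trivial
  simp only [Set.mem_iUnion] at h
  obtain ⟨n, i, h⟩ := h
  exact ⟨⟨_, n, i, rfl⟩, h⟩

/-- The open cell that contains a given point. -/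
noncomputable def cellOf (x : X) : OpenCells X := (exists_mem x).choose

theorem mem_cellOf (x : X) : x ∈ (cellOf x).1 := (exists_mem x).choose_spec

theorem cellOf_eq {x : X} {e : OpenCells X} (h : x ∈ e.1) : cellOf x = e :=
  eq_of_mem (mem_cellOf x) h

/-- Closedness of the complement can be tested cell by cell. An open cell above `p` misses the
complement; for any other cell, the whole closed cell lies in the complement, since a point of it in
the star would put the cell above `p`. -/
theorem isOpen_star [T2Space X] (p : OpenCells X) : IsOpen {x : X | p ≤ cellOf x} := by
  rw [← isClosed_compl_iff]
  refine CWComplex.isClosed_of_disjoint_openCell_or_isClosed_inter_closedCell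
    (C := (Set.univ : Set X)) (Set.subset_univ _) fun n _ j => ?_
  by_cases h : p ≤ ⟨openCell n j, n, j, rfl⟩
  · left
    rw [Set.disjoint_left]
    intro x hx hxj
    rw [Set.mem_compl_iff, Set.mem_ofPred_eq, cellOf_eq (e := ⟨openCell n j, n, j, rfl⟩) hxj] at hx
    exact hx h
  · right
    rw [Set.inter_eq_right.2]
    · exact isClosed_closedCell
    · intro x hx hpx
      refine h (hpx.trans (le_of_nonempty ⟨x, mem_cellOf x, ?_⟩))
      rw [closure_openCell_eq_closedCell]
      exact hx

/-- Closure finiteness and induction on dimension: the frontier of a cell is covered by finitely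
many open cells of smaller dimension. -/
theorem finite_Iic [T2Space X] (f : OpenCells X) : {e : OpenCells X | e ≤ f}.Finite := by
  obtain ⟨_, n, i, rfl⟩ := f
  induction n using Nat.strong_induction_on with
  | _ n ih =>
    obtain ⟨I, hI⟩ := CWComplex.cellFrontier_subset_finite_openCell n i
    have hfin : ({⟨openCell n i, n, i, rfl⟩} ∪ ⋃ m : Set.Iio n, ⋃ j : I m,
        {e : OpenCells X | e ≤ ⟨openCell m.1 j.1, m.1, j.1, rfl⟩}).Finite :=
      (Set.finite_singleton _).union
        (Set.finite_iUnion fun m => Set.finite_iUnion fun j => ih m.1 m.2 j.1)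
    refine hfin.subset fun e he => ?_
    refine Relation.ReflTransGen.head_induction_on he (Or.inl rfl) fun {e e'} hee' _ h => ?_
    rcases h with rfl | h
    · obtain ⟨x, hx, hx'⟩ := hee'
      rw [closure_openCell_eq_closedCell, ← cellFrontier_union_openCell_eq_closedCell] at hx'
      rcases hx' with hx' | hx'
      · have := hI hx'
        simp only [Set.mem_iUnion] at this
        obtain ⟨m, hm, j, hj, hxj⟩ := this
        refine Or.inr (Set.mem_iUnion.2 ⟨⟨m, hm⟩, Set.mem_iUnion.2 ⟨⟨j, hj⟩, ?_⟩⟩)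
        exact (eq_of_mem (f := ⟨openCell m j, m, j, rfl⟩) hx hxj).le
      · exact Or.inl (eq_of_mem (f := ⟨openCell n i, n, i, rfl⟩) hx hx')
    · simp only [Set.mem_iUnion] at h
      obtain ⟨m, j, h⟩ := h
      exact Or.inr (Set.mem_iUnion.2 ⟨m, Set.mem_iUnion.2 ⟨j, (le_of_nonempty hee').trans h⟩⟩)

/-! ### The action on open cells and the cells fixed by a subgroup -/

section Action

variable [MulAction G X]

/-- The action of `G` on the open cells of a `G`-complex. -/
@[reducible]
def mulAction (hX : IsGComplex G X) : MulAction G (OpenCells X) where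
  smul g e := ⟨(fun x : X => g • x) '' e.1, by
    obtain ⟨_, n, i, rfl⟩ := e
    obtain ⟨j, hj⟩ := hX.smul_openCell g n i
    exact ⟨n, j, hj⟩⟩
  one_smul e := Subtype.ext (by
    change (fun x : X => (1 : G) • x) '' e.1 = e.1
    simp)
  mul_smul g h e := Subtype.ext (by
    change (fun x : X => (g * h) • x) '' e.1 = (fun x : X => g • x) '' ((fun x : X => h • x) '' e.1)
    rw [Set.image_image]
    simp only [mul_smul])

/-- An action on the open cells compatible with the action on the points. -/
class IsCellAction (G : Type u) [Group G] (X : Type u) [TopologicalSpace X] [MulAction G X]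
    [CWComplex (Set.univ : Set X)] [MulAction G (OpenCells X)] : Prop where
  isGComplex : IsGComplex G X
  coe_smul : ∀ (g : G) (e : OpenCells X), (g • e).1 = (fun x : X => g • x) '' e.1

theorem isCellAction (hX : IsGComplex G X) : letI := mulAction hX; IsCellAction G X :=
  letI := mulAction hX
  ⟨hX, fun _ _ => rfl⟩

variable [MulAction G (OpenCells X)] [hX : IsCellAction G X]

theorem smul_mem_smul (g : G) {e : OpenCells X} {x : X} (hx : x ∈ e.1) : g • x ∈ (g • e).1 := by
  rw [IsCellAction.coe_smul]
  exact ⟨x, hx, rfl⟩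

theorem smul_le_smul (g : G) {e f : OpenCells X} (h : e ≤ f) : g • e ≤ g • f := by
  refine Relation.ReflTransGen.head_induction_on h le_rfl fun {e e'} hee' _ he' => ?_
  obtain ⟨x, hx, hx'⟩ := hee'
  refine le_trans (le_of_nonempty ?_) he'
  refine ⟨g • x, smul_mem_smul g hx, ?_⟩
  rw [IsCellAction.coe_smul]
  exact image_closure_subset_closure_image (hX.isGComplex.continuous_smul g) ⟨x, hx', rfl⟩

/-- One direction is the absence of inversions; the other holds because distinct open cells are
disjoint. -/
theorem smul_eq_iff_of_mem {g : G} {e : OpenCells X} {x : X} (hx : x ∈ e.1) :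
    g • e = e ↔ g • x = x := by
  constructor
  · intro h
    have h' := congrArg Subtype.val h
    rw [IsCellAction.coe_smul] at h'
    obtain ⟨_, n, i, rfl⟩ := e
    exact hX.isGComplex.no_inversion g n i h' x hx
  · intro h
    refine eq_of_mem (x := x) ?_ hx
    have := smul_mem_smul g hx
    rwa [h] at this

theorem stabilizer_eq_of_mem {e : OpenCells X} {x : X} (hx : x ∈ e.1) :
    MulAction.stabilizer G e = MulAction.stabilizer G x := by
  ext g
  exact smul_eq_iff_of_mem hx

/-- The fixed set of `g` is closed, so a cell meeting the closure of a fixed cell contains a fixed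
point and is therefore fixed. Thus fixed cells form a lower set. -/
theorem smul_eq_of_le [T2Space X] {g : G} {e f : OpenCells X} (h : e ≤ f) (hf : g • f = f) :
    g • e = e := by
  refine Relation.ReflTransGen.head_induction_on h hf fun {e e'} hee' _ he' => ?_
  obtain ⟨x, hx, hx'⟩ := hee'
  rw [smul_eq_iff_of_mem hx]
  have hcl : IsClosed {x : X | g • x = x} :=
    isClosed_eq (hX.isGComplex.continuous_smul g) continuous_id
  exact closure_minimal (fun y hy => (smul_eq_iff_of_mem hy).1 he') hcl hx'

variable (K : Subgroup G)

/-- The open cells fixed by a subgroup. -/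
abbrev Fixed : Type u := {e : OpenCells X // ∀ g ∈ K, g • e = e}

/-- The cell of a fixed point. -/
noncomputable def fixedCellOf (y : MulAction.fixedPoints K X) : Fixed (X := X) K :=
  ⟨cellOf y.1, fun g hg => (smul_eq_iff_of_mem (mem_cellOf y.1)).2 (y.2 ⟨g, hg⟩)⟩

theorem mem_fixedPoints_of_mem (e : Fixed (X := X) K) {x : X} (hx : x ∈ e.1.1) :
    x ∈ MulAction.fixedPoints K X :=
  fun g => (smul_eq_iff_of_mem (g := g.1) hx).1 (e.2 g.1 g.2)

theorem fixedCellOf_surjective : Function.Surjective (fixedCellOf (X := X) K) := by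
  intro e
  obtain ⟨x, hx⟩ := e.1.nonempty
  exact ⟨⟨x, mem_fixedPoints_of_mem K e hx⟩, Subtype.ext (cellOf_eq hx)⟩

theorem isOpen_fixed_star [T2Space X] (p : Fixed (X := X) K) :
    IsOpen {y | p ≤ fixedCellOf K y} :=
  (isOpen_star p.1).preimage continuous_subtype_val

/-- Each cell above `p` is reached by a chain of incidences, and all cells of the chain are fixed
because the last one is. Adding to each cell the point where its closure meets the previous cell
keeps it connected and glues the chain into a connected set through a fixed point of `p`. -/
theorem isPreconnected_fixed_star [T2Space X] (p : Fixed (X := X) K) :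
    IsPreconnected {y | p ≤ fixedCellOf K y} := by
  obtain ⟨x, hx⟩ := p.1.nonempty
  refine (Topology.IsInducing.subtypeVal.isPreconnected_image).1 ?_
  have key : ∀ f : OpenCells X, p.1 ≤ f → (∀ g ∈ K, g • f = f) →
      ∃ s : Set X, IsPreconnected s ∧ x ∈ s ∧ f.1 ⊆ s ∧
        s ⊆ Subtype.val '' {y | p ≤ fixedCellOf K y} := by
    have hsub : ∀ f : OpenCells X, p.1 ≤ f → (∀ g ∈ K, g • f = f) →
        f.1 ⊆ Subtype.val '' {y | p ≤ fixedCellOf K y} := by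
      intro f hpf hf z hz
      refine ⟨⟨z, mem_fixedPoints_of_mem K ⟨f, hf⟩ hz⟩, ?_, rfl⟩
      change p.1 ≤ cellOf z
      rwa [cellOf_eq hz]
    intro f hpf
    induction hpf with
    | refl => exact fun hf => ⟨p.1.1, p.1.isPreconnected, hx, subset_rfl, hsub _ le_rfl hf⟩
    | @tail e f hpe hef ih =>
      intro hf
      have he : ∀ g ∈ K, g • e = e := fun g hg => smul_eq_of_le (le_of_nonempty hef) (hf g hg)
      obtain ⟨s, hs, hxs, hes, hss⟩ := ih he
      obtain ⟨z, hze, hzf⟩ := hef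
      have hf' : IsPreconnected (insert z f.1) :=
        f.isPreconnected.subset_closure (Set.subset_insert _ _)
          (Set.insert_subset hzf subset_closure)
      refine ⟨s ∪ insert z f.1, hs.union z (hes hze) (Set.mem_insert _ _) hf', Or.inl hxs,
        (Set.subset_insert _ _).trans Set.subset_union_right,
        Set.union_subset hss (Set.insert_subset (hss (hes hze))
          (hsub f (hpe.trans (le_of_nonempty ⟨z, hze, hzf⟩)) hf))⟩
  refine isPreconnected_of_forall x ?_
  rintro _ ⟨y, hy, rfl⟩
  obtain ⟨s, hs, hxs, hfs, hss⟩ := key (cellOf y.1) hy (fixedCellOf K y).2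
  exact ⟨s, hss, hxs, hfs (mem_cellOf y.1), hs⟩

end Action

end OpenCells

end Cells

/-! ### Free modules over the orbit category -/

section QuotientHom

variable {G : Type u} [Group G] {S : Type u} [MulAction G S]

/-- A `G`-map out of `G/K` is determined by the image of the trivial coset. -/
theorem quotientHom_ext {K : Subgroup G} {f f' : (G ⧸ K) →[G] S}
    (h : f ((1 : G) : G ⧸ K) = f' ((1 : G) : G ⧸ K)) : f = f' := by
  refine MulActionHom.ext fun x => ?_
  induction x using QuotientGroup.induction_on with
  | H x =>
    have hx : ((x : G) : G ⧸ K) = x • ((1 : G) : G ⧸ K) :=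
      congrArg QuotientGroup.mk (mul_one x).symm
    rw [hx, map_smul, map_smul, h]

/-- The `G`-map out of `G/K` that sends the trivial coset to a given `K`-fixed point. -/
def quotientHom (K : Subgroup G) (s : S) (hs : ∀ k ∈ K, k • s = s) : (G ⧸ K) →[G] S where
  toFun := Quotient.lift (fun g : G => g • s) fun a b hab => by
    have h := hs _ (QuotientGroup.leftRel_apply.1 hab)
    change a • s = b • s
    rw [← h, smul_smul, mul_inv_cancel_left, ← h]
    simp [h]
  map_smul' g x := by
    induction x using QuotientGroup.induction_on with
    | H x => exact mul_smul g x s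

@[simp]
theorem quotientHom_mk (K : Subgroup G) (s : S) (hs : ∀ k ∈ K, k • s = s) (g : G) :
    quotientHom K s hs (g : G ⧸ K) = g • s := rfl

theorem smul_apply_one {K : Subgroup G} (f : (G ⧸ K) →[G] S) {k : G} (hk : k ∈ K) :
    k • f ((1 : G) : G ⧸ K) = f ((1 : G) : G ⧸ K) := by
  rw [← map_smul]
  congr 1
  exact QuotientGroup.eq.2 (by simpa using hk)

theorem apply_mk_eq_smul {K : Subgroup G} (f : (G ⧸ K) →[G] S) (g : G) :
    f (g : G ⧸ K) = g • f ((1 : G) : G ⧸ K) := by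
  rw [← map_smul]
  exact congrArg _ (congrArg QuotientGroup.mk (mul_one g).symm)

theorem smul_mk_eq_mk_iff {K : Subgroup G} (k g : G) :
    k • (g : G ⧸ K) = (g : G ⧸ K) ↔ g⁻¹ * k * g ∈ K := by
  change ((k * g : G) : G ⧸ K) = _ ↔ _
  rw [eq_comm, QuotientGroup.eq, mul_assoc]

end QuotientHom

namespace BredonModule

variable {G : Type u} [Group G] {F : SubgroupFamily G}

open Opposite

/-- The module whose components are the free abelian groups on a presheaf of sets. -/
noncomputable def freeModule (T : (OrbitCategory F)ᵒᵖ ⥤ Type u) : BredonModule F where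
  obj A := AddCommGrpCat.of (T.obj A →₀ ℤ)
  map f := AddCommGrpCat.ofHom (Finsupp.mapDomain.addMonoidHom (T.map f))
  map_id A := by
    refine AddCommGrpCat.hom_ext (Finsupp.addHom_ext fun t n => ?_)
    change Finsupp.mapDomain (T.map (𝟙 A)) (Finsupp.single t n) = Finsupp.single t n
    rw [Finsupp.mapDomain_single]
    simp
  map_comp f g := by
    refine AddCommGrpCat.hom_ext (Finsupp.addHom_ext fun t n => ?_)
    change Finsupp.mapDomain (T.map (f ≫ g)) (Finsupp.single t n) =
      Finsupp.mapDomain (T.map g) (Finsupp.mapDomain (T.map f) (Finsupp.single t n))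
    simp [Finsupp.mapDomain_single]

variable {T : (OrbitCategory F)ᵒᵖ ⥤ Type u} {M : BredonModule F}

/-- The basis element of the free module. -/
noncomputable def basisElt {A : (OrbitCategory F)ᵒᵖ} (t : T.obj A) : (freeModule T).obj A :=
  (Finsupp.single t 1 : T.obj A →₀ ℤ)

theorem map_basisElt {A B : (OrbitCategory F)ᵒᵖ} (f : A ⟶ B) (t : T.obj A) :
    (freeModule T).map f (basisElt t) = basisElt (T.map f t) :=
  Finsupp.mapDomain_single

/-- The homomorphism out of a free module given by a natural family of elements. -/
noncomputable def freeLift (m : ∀ A, T.obj A → M.obj A)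
    (hm : ∀ (A B : (OrbitCategory F)ᵒᵖ) (f : A ⟶ B) (t : T.obj A),
      m B (T.map f t) = M.map f (m A t)) : freeModule T ⟶ M where
  app A := AddCommGrpCat.ofHom (Finsupp.liftAddHom fun t => zmultiplesHom _ (m A t))
  naturality A B f := by
    refine AddCommGrpCat.hom_ext (Finsupp.addHom_ext fun t n => ?_)
    change Finsupp.liftAddHom (fun t => zmultiplesHom _ (m B t))
        (Finsupp.mapDomain (T.map f) (Finsupp.single t n)) =
      M.map f (Finsupp.liftAddHom (fun t => zmultiplesHom _ (m A t)) (Finsupp.single t n))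
    rw [Finsupp.mapDomain_single]
    simp only [Finsupp.liftAddHom_apply_single, zmultiplesHom_apply, hm]
    exact (map_zsmul (M.map f).hom n (m A t)).symm

theorem freeLift_basisElt (m : ∀ A, T.obj A → M.obj A)
    (hm : ∀ (A B : (OrbitCategory F)ᵒᵖ) (f : A ⟶ B) (t : T.obj A),
      m B (T.map f t) = M.map f (m A t)) {A : (OrbitCategory F)ᵒᵖ} (t : T.obj A) :
    (freeLift m hm).app A (basisElt t) = m A t := by
  change Finsupp.liftAddHom (fun t => zmultiplesHom _ (m A t)) (Finsupp.single t 1) = m A t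
  simp only [Finsupp.liftAddHom_apply_single, zmultiplesHom_apply, one_smul]

theorem freeModule_hom_ext {f f' : freeModule T ⟶ M}
    (h : ∀ (A : (OrbitCategory F)ᵒᵖ) (t : T.obj A),
      f.app A (basisElt t) = f'.app A (basisElt t)) : f = f' := by
  refine NatTrans.ext (funext fun A => AddCommGrpCat.hom_ext (Finsupp.addHom_ext fun t n => ?_))
  have hn : (Finsupp.single t n : T.obj A →₀ ℤ) = n • Finsupp.single t 1 := by simp
  rw [hn]
  exact (map_zsmul (f.app A).hom n (basisElt t)).trans
    ((congrArg (n • ·) (h A t)).trans (map_zsmul (f'.app A).hom n (basisElt t)).symm)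

theorem epi_of_surjective {N : BredonModule F} (f : M ⟶ N)
    (h : ∀ A, Function.Surjective (f.app A)) : Epi f :=
  have : ∀ A, Epi (f.app A) := fun A => (AddCommGrpCat.epi_iff_surjective _).2 (h A)
  NatTrans.epi_of_epi_app f

theorem surjective_of_epi {N : BredonModule F} (f : M ⟶ N) [Epi f] (A : (OrbitCategory F)ᵒᵖ) :
    Function.Surjective (f.app A) :=
  (AddCommGrpCat.epi_iff_surjective _).1 inferInstance

/-- Free modules on coproducts of representable presheaves are projective. -/
theorem projective_freeModule {J : Type u} (A : J → OrbitCategory F) (x : ∀ j, T.obj (op (A j)))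
    (hx : ∀ (B : OrbitCategory F) (t : T.obj (op B)),
      ∃! p : Σ j, (B ⟶ A j), T.map p.2.op (x p.1) = t) : Projective (freeModule T) := by
  refine ⟨fun {N M} f e _ => ?_⟩
  -- By Yoneda only the universal elements `x j` have to be lifted; uniqueness of the representation
  -- `p` makes the extension natural.
  choose y hy using fun j => surjective_of_epi e (op (A j)) (f.app (op (A j)) (basisElt (x j)))
  choose p hp hp' using hx
  refine ⟨freeLift (fun B t => N.map (p B.unop t).2.op (y (p B.unop t).1)) ?_, ?_⟩
  · intro B C φ t
    have h : p C.unop (T.map φ t) = ⟨(p B.unop t).1, φ.unop ≫ (p B.unop t).2⟩ := by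
      refine (hp' C.unop (T.map φ t) _ ?_).symm
      have h := hp B.unop t
      dsimp only
      rw [op_comp, T.map_comp]
      exact congrArg (T.map φ) h
    rw [h]
    dsimp only
    rw [op_comp, N.map_comp]
    rfl
  · refine freeModule_hom_ext fun B t => ?_
    rw [NatTrans.comp_app, AddCommGrpCat.comp_apply, freeLift_basisElt]
    have h := hp B.unop t
    have h1 := congrArg (fun k => k (y (p B.unop t).1)) (e.naturality (p B.unop t).2.op)
    have h2 := congrArg (fun k => k (basisElt (x (p B.unop t).1)))
      (f.naturality (p B.unop t).2.op)
    refine Eq.trans h1 ?_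
    refine (congrArg (M.map (p B.unop t).2.op) (hy _)).trans ?_
    refine Eq.trans h2.symm ?_
    change f.app B ((freeModule T).map (p B.unop t).2.op (basisElt (x (p B.unop t).1))) = _
    rw [map_basisElt, h]

/-- A presheaf given by the fixed points of a `G`-set with isotropy groups in the family. -/
structure IsFixedPointPresheaf (T : (OrbitCategory F)ᵒᵖ ⥤ Type u) (S : Type u) [MulAction G S]
    (ev : ∀ A : OrbitCategory F, T.obj (op A) → S) : Prop where
  injective : ∀ A, Function.Injective (ev A)
  smul_ev : ∀ (A) (t : T.obj (op A)), ∀ k ∈ A.subgroup, k • ev A t = ev A t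
  exists_ev_eq : ∀ (A : OrbitCategory F) (s : S), (∀ k ∈ A.subgroup, k • s = s) →
    ∃ t : T.obj (op A), ev A t = s
  ev_map : ∀ (A B : OrbitCategory F) (φ : B ⟶ A) (t : T.obj (op A)) (g : G),
    MulActionHom.toFun φ ((1 : G) : G ⧸ B.subgroup) = (g : G ⧸ A.subgroup) →
      ev B (T.map φ.op t) = g • ev A t

/-- Choosing a representative of each orbit splits the presheaf into representables, one for each
isotropy group. The abstract form serves both `homPresheaf` and restrictions of representables to a
subgroup. -/
theorem IsFixedPointPresheaf.projective {S : Type u} [MulAction G S]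
    {ev : ∀ A : OrbitCategory F, T.obj (op A) → S} (hT : IsFixedPointPresheaf T S ev)
    (hS : ∀ s : S, MulAction.stabilizer G s ∈ F) : Projective (freeModule T) := by
  let rep : MulAction.orbitRel.Quotient G S → S := Quotient.out
  let A : MulAction.orbitRel.Quotient G S → OrbitCategory F := fun j => ⟨_, hS (rep j)⟩
  choose x hx using fun j => hT.exists_ev_eq (A j) (rep j) fun k hk => hk
  refine projective_freeModule A x fun B t => ?_
  let j : MulAction.orbitRel.Quotient G S := Quotient.mk _ (ev B t)
  obtain ⟨g, hg⟩ : ∃ g : G, g • rep j = ev B t := by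
    have h : MulAction.orbitRel G S (ev B t) (rep j) :=
      (MulAction.orbitRel G S).symm (Quotient.mk_out (s := MulAction.orbitRel G S) (ev B t))
    exact MulAction.orbitRel_apply.1 h
  have hfix : ∀ k ∈ B.subgroup, k • ((g : G) : G ⧸ (A j).subgroup) = g := by
    intro k hk
    rw [smul_mk_eq_mk_iff]
    change (g⁻¹ * k * g) • rep j = rep j
    rw [mul_smul, hg, mul_smul, hT.smul_ev B t k hk, ← hg, inv_smul_smul]
  refine ⟨⟨j, quotientHom B.subgroup (g : G ⧸ (A j).subgroup) hfix⟩, ?_, ?_⟩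
  · refine hT.injective B ?_
    rw [hT.ev_map (A j) B _ (x j) g (congrArg QuotientGroup.mk (one_mul g)), hx, hg]
  · rintro ⟨j', φ⟩ h
    obtain ⟨g', hg'⟩ := QuotientGroup.mk_surjective
      (MulActionHom.toFun φ ((1 : G) : G ⧸ B.subgroup))
    have h' := hT.ev_map (A j') B φ (x j') g' hg'.symm
    dsimp only at h
    rw [h, hx] at h'
    obtain rfl : j' = j := by
      have h1 : rep j' = g'⁻¹ • ev B t := by rw [h', inv_smul_smul]
      have h2 : (Quotient.mk _ (rep j') : MulAction.orbitRel.Quotient G S) = j := by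
        refine Quotient.sound (s := MulAction.orbitRel G S) ?_
        exact MulAction.orbitRel_apply.2 ⟨g'⁻¹, h1.symm⟩
      rw [← h2]
      exact (Quotient.out_eq j').symm
    congr 1
    refine quotientHom_ext ?_
    refine hg'.symm.trans ?_
    rw [quotientHom_mk, one_smul, QuotientGroup.eq]
    change (g'⁻¹ * g) • rep _ = rep _
    rw [mul_smul, hg, h', inv_smul_smul]

/-- The presheaf `G/K ↦ Map_G(G/K, S)` of fixed points of a `G`-set `S`. -/
def homPresheaf (F : SubgroupFamily G) (S : Type u) [MulAction G S] :
    (OrbitCategory F)ᵒᵖ ⥤ Type u where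
  obj A := (G ⧸ A.unop.subgroup) →[G] S
  map φ := TypeCat.ofHom fun t => MulActionHom.comp t φ.unop

theorem isFixedPointPresheaf_homPresheaf (S : Type u) [MulAction G S] :
    IsFixedPointPresheaf (homPresheaf F S) S
      fun A t => MulActionHom.toFun t ((1 : G) : G ⧸ A.subgroup) where
  injective A _ _ h := quotientHom_ext h
  smul_ev A t _ hk := smul_apply_one (show (G ⧸ A.subgroup) →[G] S from t) hk
  exists_ev_eq A s hs :=
    ⟨(quotientHom A.subgroup s hs : (G ⧸ A.subgroup) →[G] S), one_smul G s⟩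
  ev_map A B φ t g h := by
    change MulActionHom.toFun t (MulActionHom.toFun φ ((1 : G) : G ⧸ B.subgroup)) = _
    rw [h]
    exact apply_mk_eq_smul (show (G ⧸ A.subgroup) →[G] S from t) g

/-- The free module on a `G`-set. -/
noncomputable abbrev permModule (F : SubgroupFamily G) (S : Type u) [MulAction G S] :
    BredonModule F := freeModule (homPresheaf F S)

theorem projective_permModule (S : Type u) [MulAction G S]
    (hS : ∀ s : S, MulAction.stabilizer G s ∈ F) : Projective (permModule F S) :=
  (isFixedPointPresheaf_homPresheaf S).projective hS

theorem closure_basisElt (A : (OrbitCategory F)ᵒᵖ) :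
    AddSubgroup.closure (Set.range (basisElt : T.obj A → (freeModule T).obj A)) = ⊤ := by
  rw [eq_top_iff]
  intro x _
  induction x using Finsupp.induction_linear with
  | zero => exact zero_mem _
  | add x y hx hy => exact add_mem (hx trivial) (hy trivial)
  | single t n =>
    have hn : (Finsupp.single t n : T.obj A →₀ ℤ) = n • Finsupp.single t 1 := by simp
    rw [hn]
    have h : (basisElt t : (freeModule T).obj A) ∈ AddSubgroup.closure (Set.range basisElt) :=
      AddSubgroup.subset_closure (Set.mem_range_self t)
    exact zsmul_mem h n

/-- Each orbit representative is a fixed point of its own stabilizer, hence an element of the module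
there; these finitely many elements generate. -/
theorem isFinitelyGenerated_permModule (S : Type u) [MulAction G S]
    (hS : ∀ s : S, MulAction.stabilizer G s ∈ F) (S₀ : Set S) (hfin : S₀.Finite)
    (hS₀ : ∀ s : S, ∃ g : G, ∃ s₀ ∈ S₀, g • s₀ = s) : (permModule F S).IsFinitelyGenerated := by
  obtain ⟨n, σ, -, rfl⟩ := hfin.fin_param
  let A : Fin n → OrbitCategory F := fun i => ⟨_, hS (σ i)⟩
  let x : ∀ i, (homPresheaf F S).obj (op (A i)) := fun i =>
    (quotientHom (A i).subgroup (σ i) fun _ hk => hk : (G ⧸ (A i).subgroup) →[G] S)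
  refine ⟨n, A, fun i => basisElt (x i), fun B => ?_⟩
  rw [eq_top_iff, ← closure_basisElt]
  refine AddSubgroup.closure_mono ?_
  rintro _ ⟨t, rfl⟩
  let t' : (G ⧸ B.subgroup) →[G] S := t
  obtain ⟨g, _, ⟨i, rfl⟩, hg⟩ := hS₀ (t' ((1 : G) : G ⧸ B.subgroup))
  have hfix : ∀ k ∈ B.subgroup, k • ((g : G) : G ⧸ (A i).subgroup) = g := by
    intro k hk
    rw [smul_mk_eq_mk_iff]
    change (g⁻¹ * k * g) • σ i = σ i
    rw [mul_smul, hg, mul_smul, smul_apply_one t' hk, ← hg, inv_smul_smul]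
  refine ⟨i, quotientHom B.subgroup (g : G ⧸ (A i).subgroup) hfix, ?_⟩
  rw [map_basisElt]
  congr 1
  refine quotientHom_ext (f := t') ?_
  rw [← hg]
  exact (congrArg (· • σ i) (one_mul g)).symm

/-- The coproduct of the presheaves represented by a family of objects. -/
def sumRep {J : Type u} (A : J → OrbitCategory F) : (OrbitCategory F)ᵒᵖ ⥤ Type u where
  obj B := Σ j, (B.unop ⟶ A j)
  map φ := TypeCat.ofHom fun t => ⟨t.1, φ.unop ≫ t.2⟩
  map_id _ := by
    refine ConcreteCategory.hom_ext _ _ fun t => ?_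
    exact Sigma.ext rfl (heq_of_eq (Category.id_comp t.2))
  map_comp f g := by
    refine ConcreteCategory.hom_ext _ _ fun t => ?_
    exact Sigma.ext rfl (heq_of_eq (Category.assoc g.unop f.unop t.2))

theorem projective_sumRep {J : Type u} (A : J → OrbitCategory F) :
    Projective (freeModule (sumRep A)) := by
  refine projective_freeModule A (fun j => ⟨j, 𝟙 _⟩) fun B t => ⟨t, ?_, ?_⟩
  · exact Sigma.ext rfl (heq_of_eq (Category.comp_id t.2))
  · rintro ⟨j, φ⟩ rfl
    exact Sigma.ext rfl (heq_of_eq (Category.comp_id φ).symm)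

theorem exists_epi_sumRep (M : BredonModule F) :
    ∃ (J : Type u) (A : J → OrbitCategory F) (f : freeModule (sumRep A) ⟶ M), Epi f := by
  refine ⟨Σ A : OrbitCategory F, M.obj (op A), Sigma.fst,
    freeLift (fun B t => M.map t.2.op t.1.2) ?_, epi_of_surjective _ fun B m => ?_⟩
  · intro B C φ t
    change M.map (φ.unop ≫ t.2).op t.1.2 = _
    rw [op_comp, M.map_comp]
    rfl
  · refine ⟨basisElt (T := sumRep _) ⟨⟨B.unop, m⟩, 𝟙 _⟩, ?_⟩
    refine (freeLift_basisElt _ _ _).trans ?_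
    change M.map (𝟙 B) m = m
    simp

instance : EnoughProjectives (BredonModule F) where
  presentation M := by
    obtain ⟨J, A, f, hf⟩ := exists_epi_sumRep M
    exact ⟨{ p := freeModule (sumRep A), projective := projective_sumRep A, f := f, epi := hf }⟩

/-- Reduces statements about projectives to free modules, and supplies an ℓ₁-norm for projectives
that are not finitely generated. -/
theorem exists_retract_sumRep (M : BredonModule F) [Projective M] :
    ∃ (J : Type u) (A : J → OrbitCategory F) (i : M ⟶ freeModule (sumRep A))
      (r : freeModule (sumRep A) ⟶ M), i ≫ r = 𝟙 M := by
  obtain ⟨J, A, r, hr⟩ := exists_epi_sumRep M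
  exact ⟨J, A, Projective.factorThru (𝟙 M) r, r, Projective.factorThru_comp _ _⟩

end BredonModule

/-! ### Restriction of modules to a subgroup -/

section Restriction

open Opposite

variable {G : Type u} [Group G]

namespace OrbitCategory

variable (F : SubgroupFamily G) (H : Subgroup G)

/-- The inclusion `H/L → G/L` for `L ≤ H ≤ G`. -/
def quotientIncl (L : Subgroup H) : (H ⧸ L) →[H] (G ⧸ L.map H.subtype) :=
  quotientHom L ((1 : G) : G ⧸ L.map H.subtype) fun k hk => by
    change ((k : G) • ((1 : G) : G ⧸ L.map H.subtype)) = _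
    rw [smul_mk_eq_mk_iff]
    simpa using hk

theorem quotientIncl_mk (L : Subgroup H) (h : H) :
    quotientIncl H L (h : H ⧸ L) = ((h : G) : G ⧸ L.map H.subtype) :=
  congrArg QuotientGroup.mk (mul_one (h : G))

variable {H} in
/-- The `G`-map `G/L → G/L'` induced by an `H`-map `H/L → H/L'`. -/
def inductionHom {L L' : Subgroup H} (f : (H ⧸ L) →[H] (H ⧸ L')) :
    (G ⧸ L.map H.subtype) →[G] (G ⧸ L'.map H.subtype) :=
  quotientHom (L.map H.subtype) (quotientIncl H L' (f ((1 : H) : H ⧸ L))) (by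
    rintro _ ⟨k, hk, rfl⟩
    refine (map_smul (quotientIncl H L') k _).symm.trans ?_
    rw [smul_apply_one f hk])

variable {H} in
theorem inductionHom_mk {L L' : Subgroup H} (f : (H ⧸ L) →[H] (H ⧸ L')) (h : H) :
    inductionHom f ((h : G) : G ⧸ L.map H.subtype) = quotientIncl H L' (f (h : H ⧸ L)) := by
  rw [apply_mk_eq_smul f h]
  exact (map_smul (quotientIncl H L') h _).symm

/-- The functor from the orbit category of `H` to the one of `G` sending `H/L` to `G/L`. -/
def induction : OrbitCategory (F.inter H) ⥤ OrbitCategory F where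
  obj L := ⟨L.subgroup.map H.subtype, by
    obtain ⟨K, hK, h⟩ := L.mem
    refine F.le_mem' K hK _ ?_
    rintro _ ⟨x, hx, rfl⟩
    rw [h] at hx
    exact hx⟩
  map f := inductionHom f
  map_id L := quotientHom_ext
    ((inductionHom_mk (MulActionHom.id H) 1).trans (quotientIncl_mk H L.subgroup 1))
  map_comp {L L' L''} f g := quotientHom_ext (by
    let f' : (H ⧸ L.subgroup) →[H] (H ⧸ L'.subgroup) := f
    let g' : (H ⧸ L'.subgroup) →[H] (H ⧸ L''.subgroup) := g
    change inductionHom (g'.comp f') ((1 : H) : G) = inductionHom g' (inductionHom f' ((1 : H) : G))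
    rw [inductionHom_mk, inductionHom_mk]
    obtain ⟨h, hh⟩ := QuotientGroup.mk_surjective (f' ((1 : H) : H ⧸ L.subgroup))
    rw [MulActionHom.comp_apply, ← hh, quotientIncl_mk, inductionHom_mk])

theorem induction_map_one {L L' : OrbitCategory (F.inter H)} (f : L ⟶ L') (h : H)
    (hf : MulActionHom.toFun f ((1 : H) : H ⧸ L.subgroup) = (h : H ⧸ L'.subgroup)) :
    MulActionHom.toFun ((induction F H).map f) ((1 : G) : G ⧸ L.subgroup.map H.subtype) =
      ((h : G) : G ⧸ L'.subgroup.map H.subtype) :=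
  (inductionHom_mk (show (H ⧸ L.subgroup) →[H] (H ⧸ L'.subgroup) from f) 1).trans
    ((congrArg _ hf).trans (quotientIncl_mk H L'.subgroup h))

end OrbitCategory

namespace BredonModule

variable (F : SubgroupFamily G) (H : Subgroup G)

/-- The restriction of modules over the orbit category to a subgroup. -/
noncomputable abbrev restriction : BredonModule F ⥤ BredonModule (F.inter H) :=
  (Functor.whiskeringLeft _ _ _).obj (OrbitCategory.induction F H).op

variable {F}

theorem stabilizer_mk_mem (A : OrbitCategory F) (x : G ⧸ A.subgroup) :
    MulAction.stabilizer G x ∈ F := by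
  obtain ⟨g, rfl⟩ := QuotientGroup.mk_surjective x
  refine F.le_mem' _ (F.conj_mem' _ A.mem g) _ fun k hk => ?_
  refine ⟨g⁻¹ * k * g, (smul_mk_eq_mk_iff k g).1 hk, ?_⟩
  simp [mul_assoc]

/-- A G-map from G/L to G/K is an L-fixed point of G/K. So the restriction is the fixed point
presheaf of the disjoint union of the G/K seen as an H-set, with isotropy groups the intersections
with `H` of members of `F`. -/
theorem projective_restriction_sumRep {J : Type u} (A : J → OrbitCategory F) :
    Projective ((restriction F H).obj (freeModule (sumRep A))) := by
  let T : (OrbitCategory (F.inter H))ᵒᵖ ⥤ Type u := (OrbitCategory.induction F H).op ⋙ sumRep A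
  let ev : ∀ L : OrbitCategory (F.inter H), T.obj (op L) → Σ j, G ⧸ (A j).subgroup :=
    fun L t => ⟨t.1, MulActionHom.toFun t.2 ((1 : G) : G ⧸ L.subgroup.map H.subtype)⟩
  have hT : IsFixedPointPresheaf T (Σ j, G ⧸ (A j).subgroup) ev :=
    { injective := by
        rintro L ⟨j, φ⟩ ⟨j', φ'⟩ h
        obtain rfl : j = j' := congrArg Sigma.fst h
        have h' := eq_of_heq (Sigma.mk.inj h).2
        exact congrArg (Sigma.mk j) (quotientHom_ext h')
      smul_ev := by
        rintro L ⟨j, φ⟩ k hk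
        refine congrArg (Sigma.mk j) ?_
        exact smul_apply_one (show (G ⧸ L.subgroup.map H.subtype) →[G] (G ⧸ (A j).subgroup) from φ)
          (Subgroup.mem_map_of_mem H.subtype hk)
      exists_ev_eq := by
        rintro L ⟨j, x⟩ h
        refine ⟨⟨j, quotientHom (L.subgroup.map H.subtype) x ?_⟩, congrArg (Sigma.mk j)
          (one_smul G x)⟩
        rintro _ ⟨k, hk, rfl⟩
        exact eq_of_heq (Sigma.mk.inj (h k hk)).2
      ev_map := by
        rintro L L' φ ⟨j, t⟩ h hφ
        refine congrArg (Sigma.mk j) ?_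
        change MulActionHom.toFun t (MulActionHom.toFun ((OrbitCategory.induction F H).map φ)
          ((1 : G) : G ⧸ L'.subgroup.map H.subtype)) = _
        rw [OrbitCategory.induction_map_one F H φ h hφ]
        exact apply_mk_eq_smul
          (show (G ⧸ L.subgroup.map H.subtype) →[G] (G ⧸ (A j).subgroup) from t) (h : G) }
  refine hT.projective ?_
  rintro ⟨j, x⟩
  refine ⟨_, stabilizer_mk_mem (A j) x, ?_⟩
  ext k
  exact ⟨fun h => eq_of_heq (Sigma.mk.inj h).2, fun h => congrArg (Sigma.mk j) h⟩

theorem projective_restriction (M : BredonModule F) [Projective M] :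
    Projective ((restriction F H).obj M) := by
  obtain ⟨J, A, i, r, hir⟩ := exists_retract_sumRep M
  have := projective_restriction_sumRep H A
  refine ⟨fun f e _ => ⟨(restriction F H).map i ≫
    Projective.factorThru ((restriction F H).map r ≫ f) e, ?_⟩⟩
  rw [Category.assoc, Projective.factorThru_comp, ← Category.assoc, ← Functor.map_comp, hir,
    CategoryTheory.Functor.map_id, Category.id_comp]

/-- The restriction of a projective resolution to a subgroup. -/
noncomputable def restrictProjectiveResolution {M : BredonModule F} (P : ProjectiveResolution M) :
    ProjectiveResolution ((restriction F H).obj M) where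
  complex := ((restriction F H).mapHomologicalComplex _).obj P.complex
  projective n := projective_restriction H (P.complex.X n)
  π := ((restriction F H).mapHomologicalComplex _).map P.π ≫
    (HomologicalComplex.singleMapHomologicalComplex (restriction F H) _ 0).hom.app M
  quasiIso := by
    -- Precomposition with a functor is exact, so it preserves quasi-isomorphisms.
    have h : QuasiIso (((restriction F H).mapHomologicalComplex _).map P.π) := inferInstance
    have : IsIso ((HomologicalComplex.singleMapHomologicalComplex (restriction F H)
      (ComplexShape.down ℕ) 0).hom.app M) := inferInstance
    exact (quasiIso_iff_comp_right _ _).2 h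

/-- The restriction of a projective resolution of the trivial module to a subgroup. -/
noncomputable def restrictResolution (P : ProjectiveResolution (trivialZ F)) :
    ProjectiveResolution (trivialZ (F.inter H)) :=
  -- The restriction of the constant module is definitionally the constant module over `H`.
  restrictProjectiveResolution H P

end BredonModule

end Restriction

/-! ### Extending a partial projective resolution -/

section PartialResolution

open Limits

universe v w

variable {C : Type w} [Category.{v} C] [Abelian C] [EnoughProjectives C]

theorem projective_d_comp {X Y : C} (f : X ⟶ Y) : Projective.d f ≫ f = 0 :=
  (Category.assoc (Projective.π (kernel f)) (kernel.ι f) f).trans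
    ((congrArg (Projective.π (kernel f) ≫ ·) (kernel.condition f)).trans comp_zero)

variable {X₀ X₁ X₂ : C} (d₀ : X₁ ⟶ X₀) (d₁ : X₂ ⟶ X₁) (w : d₁ ≫ d₀ = 0)

/-- The complex obtained from a partial resolution by iterated projective covers of kernels. -/
noncomputable def extendComplex : ChainComplex C ℕ :=
  ChainComplex.mk X₀ X₁ X₂ d₀ d₁ w fun S => ⟨_, Projective.d S.f, projective_d_comp S.f⟩

/-- In degree one this is the hypothesis; above it, each new term is a projective mapping onto the
kernel of the preceding differential. -/
theorem extendComplex_exactAt_succ (h : (ShortComplex.mk d₁ d₀ w).Exact) (n : ℕ) :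
    (extendComplex d₀ d₁ w).ExactAt (n + 1) := by
  rw [HomologicalComplex.exactAt_iff' _ (n + 2) (n + 1) n (by simp) (by simp)]
  have key : (ChainComplex.mkAux X₀ X₁ X₂ d₀ d₁ w
      (fun S => ⟨_, Projective.d S.f, projective_d_comp S.f⟩) n).Exact := by
    cases n with
    | zero => exact h
    | succ n => exact exact_d_f _
  rw [ChainComplex.mkAux_eq_shortComplex_mk_d_comp_d] at key
  exact key

theorem projective_extendComplex [Projective X₀] [Projective X₁] [Projective X₂] (n : ℕ) :
    Projective ((extendComplex d₀ d₁ w).X n) := by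
  match n with
  | 0 => exact ‹Projective X₀›
  | 1 => exact ‹Projective X₁›
  | 2 => exact ‹Projective X₂›
  | n + 3 => exact Projective.projective_over _

theorem extendComplex_d_one_zero : (extendComplex d₀ d₁ w).d 1 0 = d₀ :=
  ChainComplex.mk_d_1_0 _ _ _ _ _ _ _

/-- A partial projective resolution extends to a projective resolution. -/
theorem exists_projectiveResolution {Z : C} (ε : X₀ ⟶ Z) [Epi ε] [Projective X₀] [Projective X₁]
    [Projective X₂] (wε : d₀ ≫ ε = 0) (h₀ : (ShortComplex.mk d₀ ε wε).Exact)
    (h₁ : (ShortComplex.mk d₁ d₀ w).Exact) :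
    ∃ P : ProjectiveResolution Z, P.complex = extendComplex d₀ d₁ w := by
  let ε' : (extendComplex d₀ d₁ w).X 0 ⟶ Z := ε
  have hε' : (extendComplex d₀ d₁ w).d 1 0 ≫ ε' = 0 := by
    rw [extendComplex_d_one_zero]
    exact wε
  refine ⟨{ complex := extendComplex d₀ d₁ w
            projective := projective_extendComplex d₀ d₁ w
            π := (ChainComplex.toSingle₀Equiv _ _).symm ⟨ε', hε'⟩
            quasiIso := ⟨fun n => ?_⟩ }, rfl⟩
  cases n with
  | zero =>
    rw [ChainComplex.quasiIsoAt₀_iff, ShortComplex.quasiIso_iff_of_zeros']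
    · have hg : ((ChainComplex.toSingle₀Equiv _ _).symm ⟨ε', hε'⟩).f 0 = ε' :=
        ChainComplex.toSingle₀Equiv_symm_apply_f_zero _ _
      have e : ShortComplex.mk d₀ ε wε ≅ ShortComplex.mk ((extendComplex d₀ d₁ w).d 1 0)
          (((ChainComplex.toSingle₀Equiv _ _).symm ⟨ε', hε'⟩).f 0) (by rw [hg]; exact hε') := by
        refine ShortComplex.isoMk (Iso.refl _) (Iso.refl _) (Iso.refl _) ?_ ?_
        · change 𝟙 X₁ ≫ (extendComplex d₀ d₁ w).d 1 0 = d₀ ≫ 𝟙 X₀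
          rw [extendComplex_d_one_zero]
          exact (Category.id_comp d₀).trans (Category.comp_id d₀).symm
        · change 𝟙 X₀ ≫ ((ChainComplex.toSingle₀Equiv _ _).symm ⟨ε', hε'⟩).f 0 = ε ≫ 𝟙 Z
          rw [hg]
          exact (Category.id_comp ε).trans (Category.comp_id ε).symm
      exact (ShortComplex.exact_and_epi_g_iff_of_iso e).1 ⟨h₀, ‹Epi ε›⟩
    all_goals rfl
  | succ n =>
    rw [quasiIsoAt_iff_exactAt']
    · exact extendComplex_exactAt_succ d₀ d₁ w h₁ n
    · exact ChainComplex.exactAt_succ_single_obj _ _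

end PartialResolution

/-! ### Resolutions from preorders with a group action -/

namespace BredonModule

open Opposite

variable {G : Type u} [Group G] {F : SubgroupFamily G}

/-- Homology of functors is computed objectwise. -/
theorem exact_of_app (S : ShortComplex (BredonModule F))
    (h : ∀ (A : (OrbitCategory F)ᵒᵖ) (x : S.X₂.obj A), S.g.app A x = 0 →
      ∃ y : S.X₁.obj A, S.f.app A y = x) : S.Exact := by
  rw [ShortComplex.exact_iff_isZero_homology, Functor.isZero_iff]
  intro A
  have hA : (S.map ((evaluation _ _).obj A)).Exact := (ShortComplex.ab_exact_iff _).2 (h A)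
  rw [ShortComplex.exact_iff_isZero_homology] at hA
  exact hA.of_iso (S.mapHomologyIso ((evaluation _ _).obj A)).symm

theorem app_exact (S : ShortComplex (BredonModule F)) (hS : S.Exact) (A : (OrbitCategory F)ᵒᵖ)
    (x : S.X₂.obj A) (hx : S.g.app A x = 0) : ∃ y : S.X₁.obj A, S.f.app A y = x :=
  (ShortComplex.ab_exact_iff _).1 (hS.map ((evaluation _ _).obj A)) x hx

section AddHom

variable {T : (OrbitCategory F)ᵒᵖ ⥤ Type u} {A : (OrbitCategory F)ᵒᵖ} {N : Type*} [AddCommGroup N]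

theorem freeModule_addHom_ext {f f' : (freeModule T).obj A →+ N}
    (h : ∀ t : T.obj A, f (basisElt t) = f' (basisElt t)) : f = f' := by
  refine Finsupp.addHom_ext fun t n => ?_
  have hn : (Finsupp.single t n : T.obj A →₀ ℤ) = n • Finsupp.single t 1 := by simp
  rw [hn]
  exact (map_zsmul f n (basisElt t)).trans
    ((congrArg (n • ·) (h t)).trans (map_zsmul f' n (basisElt t)).symm)

/-- The additive map out of a component of a free module with given values on the basis. -/
noncomputable def freeAddLift (m : T.obj A → N) : (freeModule T).obj A →+ N :=
  Finsupp.liftAddHom fun t => zmultiplesHom N (m t)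

theorem freeAddLift_basisElt (m : T.obj A → N) (t : T.obj A) :
    freeAddLift m (basisElt t) = m t := by
  change Finsupp.liftAddHom (fun t => zmultiplesHom N (m t)) (Finsupp.single t 1) = m t
  simp only [Finsupp.liftAddHom_apply_single, zmultiplesHom_apply, one_smul]

end AddHom

/-! ### Maps between permutation modules and the augmentation -/

section PermMap

variable {S S' : Type u} [MulAction G S] [MulAction G S']

/-- Composition of an element of the presheaf of a `G`-set with a `G`-map. -/
def postcomp (f : S →[G] S') {A : (OrbitCategory F)ᵒᵖ} (t : (homPresheaf F S).obj A) :
    (homPresheaf F S').obj A := MulActionHom.comp f t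

/-- The fixed point given by an element of the presheaf of a `G`-set. -/
def evalOne {A : (OrbitCategory F)ᵒᵖ} (t : (homPresheaf F S).obj A) : S :=
  MulActionHom.toFun t ((1 : G) : G ⧸ A.unop.subgroup)

/-- The element of the presheaf of a `G`-set given by a fixed point. -/
def ofFixed (A : (OrbitCategory F)ᵒᵖ) (s : S) (hs : ∀ k ∈ A.unop.subgroup, k • s = s) :
    (homPresheaf F S).obj A := quotientHom A.unop.subgroup s hs

theorem evalOne_ofFixed (A : (OrbitCategory F)ᵒᵖ) (s : S)
    (hs : ∀ k ∈ A.unop.subgroup, k • s = s) : evalOne (ofFixed A s hs) = s := one_smul G s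

theorem smul_evalOne {A : (OrbitCategory F)ᵒᵖ} (t : (homPresheaf F S).obj A) :
    ∀ k ∈ A.unop.subgroup, k • evalOne t = evalOne t := fun _ hk =>
  smul_apply_one (show (G ⧸ A.unop.subgroup) →[G] S from t) hk

theorem evalOne_injective {A : (OrbitCategory F)ᵒᵖ} {t t' : (homPresheaf F S).obj A}
    (h : evalOne t = evalOne t') : t = t' := quotientHom_ext h

theorem evalOne_postcomp (f : S →[G] S') {A : (OrbitCategory F)ᵒᵖ}
    (t : (homPresheaf F S).obj A) : evalOne (postcomp f t) = f (evalOne t) := rfl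

theorem smul_map_eq_of_fixed (f : S →[G] S') {K : Subgroup G} {s : S}
    (hs : ∀ k ∈ K, k • s = s) : ∀ k ∈ K, k • f s = f s := fun k hk => by
  rw [← map_smul, hs k hk]

theorem postcomp_ofFixed (f : S →[G] S') (A : (OrbitCategory F)ᵒᵖ) (s : S)
    (hs : ∀ k ∈ A.unop.subgroup, k • s = s) :
    postcomp f (ofFixed A s hs) = ofFixed A (f s) (smul_map_eq_of_fixed f hs) :=
  evalOne_injective (by rw [evalOne_postcomp, evalOne_ofFixed, evalOne_ofFixed])

/-- The homomorphism of free modules induced by a `G`-map. -/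
noncomputable def permMap (f : S →[G] S') : permModule F S ⟶ permModule F S' :=
  freeLift (fun _ t => basisElt (postcomp f t)) fun _ _ φ t => (map_basisElt φ (postcomp f t)).symm

theorem permMap_basisElt (f : S →[G] S') {A : (OrbitCategory F)ᵒᵖ}
    (t : (homPresheaf F S).obj A) :
    (permMap f).app A (basisElt t) = basisElt (postcomp f t) :=
  freeLift_basisElt _ _ t

variable (F S) in
/-- The augmentation of the free module on a `G`-set. -/
noncomputable def augmentation : permModule F S ⟶ trivialZ F :=
  freeLift (fun _ _ => (ULift.up 1 : ULift.{u} ℤ)) fun _ _ _ _ => rfl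

theorem augmentation_basisElt {A : (OrbitCategory F)ᵒᵖ} (t : (homPresheaf F S).obj A) :
    (augmentation F S).app A (basisElt t) = (ULift.up 1 : ULift.{u} ℤ) :=
  freeLift_basisElt _ _ t

/-- The fixed points of a subgroup on a set with an action. -/
abbrev FixedElts (V : Type u) [MulAction G V] (K : Subgroup G) : Type u :=
  {v : V // ∀ k ∈ K, k • v = v}

theorem augmentation_epi (hne : ∀ K ∈ F, Nonempty (FixedElts S K)) : Epi (augmentation F S) := by
  refine epi_of_surjective _ fun A n => ?_
  obtain ⟨p⟩ := hne _ A.unop.mem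
  refine ⟨(ULift.down (show ULift.{u} ℤ from n)) • basisElt (ofFixed A p.1 p.2), ?_⟩
  refine (map_zsmul ((augmentation F S).app A).hom _ _).trans ?_
  refine (congrArg _ (augmentation_basisElt _)).trans ?_
  refine ULift.ext _ _ ?_
  change (ULift.down (show ULift.{u} ℤ from n)) • (1 : ℤ) = _
  simp

end PermMap

/-! ### The chain modules of a preorder in degrees at most two -/

section Chains

/-- An action on a preorder by monotone maps. -/
class IsMonotoneAction (G : Type u) [Group G] (V : Type u) [Preorder V] [MulAction G V] : Prop where
  smul_le_smul : ∀ (g : G) {a b : V}, a ≤ b → g • a ≤ g • b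

variable (G) (V : Type u) [Preorder V] [MulAction G V] [IsMonotoneAction G V]

/-- Pairs of comparable elements of a preorder. -/
abbrev LEPairs : Type u := {p : V × V // p.1 ≤ p.2}

/-- Triples of successively comparable elements of a preorder. -/
abbrev LETriples : Type u := {p : V × V × V // p.1 ≤ p.2.1 ∧ p.2.1 ≤ p.2.2}

instance : MulAction G (LEPairs V) where
  smul g p := ⟨g • p.1, IsMonotoneAction.smul_le_smul g p.2⟩
  one_smul p := Subtype.ext (one_smul G p.1)
  mul_smul g h p := Subtype.ext (mul_smul g h p.1)

instance : MulAction G (LETriples V) where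
  smul g p := ⟨g • p.1, IsMonotoneAction.smul_le_smul g p.2.1, IsMonotoneAction.smul_le_smul g p.2.2⟩
  one_smul p := Subtype.ext (one_smul G p.1)
  mul_smul g h p := Subtype.ext (mul_smul g h p.1)

/-- The first element of a pair. -/
def pairFst : LEPairs V →[G] V := ⟨fun p => p.1.1, fun _ _ => rfl⟩
/-- The second element of a pair. -/
def pairSnd : LEPairs V →[G] V := ⟨fun p => p.1.2, fun _ _ => rfl⟩
/-- The first two elements of a triple. -/
def tripleFstSnd : LETriples V →[G] LEPairs V :=
  ⟨fun p => ⟨(p.1.1, p.1.2.1), p.2.1⟩, fun _ _ => rfl⟩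
/-- The first and the last element of a triple. -/
def tripleFstTrd : LETriples V →[G] LEPairs V :=
  ⟨fun p => ⟨(p.1.1, p.1.2.2), p.2.1.trans p.2.2⟩, fun _ _ => rfl⟩
/-- The last two elements of a triple. -/
def tripleSndTrd : LETriples V →[G] LEPairs V :=
  ⟨fun p => ⟨p.1.2, p.2.2⟩, fun _ _ => rfl⟩

variable (F) in
/-- The boundary of a one-chain of the order complex. -/
noncomputable def orderBoundaryOne : permModule F (LEPairs V) ⟶ permModule F V :=
  permMap (pairSnd G V) - permMap (pairFst G V)

variable (F) in
/-- The boundary of a two-chain of the order complex. -/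
noncomputable def orderBoundaryTwo : permModule F (LETriples V) ⟶ permModule F (LEPairs V) :=
  permMap (tripleSndTrd G V) - permMap (tripleFstTrd G V) + permMap (tripleFstSnd G V)

variable {V} {G}

theorem orderBoundaryOne_basisElt {A : (OrbitCategory F)ᵒᵖ}
    (t : (homPresheaf F (LEPairs V)).obj A) :
    (orderBoundaryOne G F V).app A (basisElt t) =
      basisElt (postcomp (pairSnd G V) t) -
        basisElt (postcomp (pairFst G V) t) := by
  rw [← permMap_basisElt, ← permMap_basisElt]
  rfl

theorem orderBoundaryTwo_basisElt {A : (OrbitCategory F)ᵒᵖ}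
    (t : (homPresheaf F (LETriples V)).obj A) :
    (orderBoundaryTwo G F V).app A (basisElt t) =
      basisElt (postcomp (tripleSndTrd G V) t) -
        basisElt (postcomp (tripleFstTrd G V) t) +
        basisElt (postcomp (tripleFstSnd G V) t) := by
  rw [← permMap_basisElt, ← permMap_basisElt, ← permMap_basisElt]
  rfl

theorem orderBoundaryOne_comp : orderBoundaryOne G F V ≫ augmentation F V = 0 := by
  refine freeModule_hom_ext fun A t => ?_
  change (augmentation F V).app A ((orderBoundaryOne G F V).app A (basisElt t)) = 0
  rw [orderBoundaryOne_basisElt, map_sub]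
  exact sub_eq_zero.2 ((augmentation_basisElt _).trans (augmentation_basisElt _).symm)

theorem orderBoundaryTwo_comp : orderBoundaryTwo G F V ≫ orderBoundaryOne G F V = 0 := by
  refine freeModule_hom_ext fun A t => ?_
  change (orderBoundaryOne G F V).app A ((orderBoundaryTwo G F V).app A (basisElt t)) = 0
  rw [orderBoundaryTwo_basisElt, map_add, map_sub, orderBoundaryOne_basisElt,
    orderBoundaryOne_basisElt, orderBoundaryOne_basisElt]
  have h1 : postcomp (pairSnd G V) (postcomp (tripleSndTrd G V) t) =
    postcomp (pairSnd G V) (postcomp (tripleFstTrd G V) t) := rfl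
  have h2 : postcomp (pairFst G V) (postcomp (tripleSndTrd G V) t) =
    postcomp (pairSnd G V) (postcomp (tripleFstSnd G V) t) := rfl
  have h3 : postcomp (pairFst G V) (postcomp (tripleFstTrd G V) t) =
    postcomp (pairFst G V) (postcomp (tripleFstSnd G V) t) := rfl
  rw [h1, h2, h3]
  abel

/-- Take coefficients in the cokernel of the boundary. The classes of the vertices agree along
comparable pairs, so `h₀` makes them all equal; the quotient map then factors through the
augmentation and kills its kernel. -/
theorem orderBoundaryOne_exact
    (h₀ : ∀ K ∈ F, ∀ (N : Type u) (v : FixedElts V K → N), (∀ p q, p ≤ q → v p = v q) →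
      ∀ p q, v p = v q)
    (hne : ∀ K ∈ F, Nonempty (FixedElts V K)) :
    (ShortComplex.mk _ _ (orderBoundaryOne_comp (F := F) (V := V))).Exact := by
  refine exact_of_app _ fun A x hx => ?_
  change (augmentation F V).app A x = 0 at hx
  let B := ((orderBoundaryOne G F V).app A).hom.range
  let N := (permModule F V).obj A ⧸ B
  let v : FixedElts V A.unop.subgroup → N := fun p =>
    QuotientAddGroup.mk (basisElt (ofFixed A p.1 p.2))
  have hv : ∀ p q, p ≤ q → v p = v q := by
    intro p q hpq
    refine (QuotientAddGroup.eq.2 ?_)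
    refine ⟨basisElt (ofFixed A ⟨(p.1, q.1), hpq⟩ fun k hk => Subtype.ext
      (Prod.ext (p.2 k hk) (q.2 k hk))), ?_⟩
    refine (orderBoundaryOne_basisElt _).trans ?_
    rw [sub_eq_neg_add, postcomp_ofFixed, postcomp_ofFixed]
    rfl
  obtain ⟨p₀⟩ := hne _ A.unop.mem
  have key : (QuotientAddGroup.mk' B) =
      ((zmultiplesHom N (v p₀)).comp AddEquiv.ulift.toAddMonoidHom).comp
        ((augmentation F V).app A).hom := by
    refine freeModule_addHom_ext fun t => ?_
    have h := h₀ _ A.unop.mem N v hv ⟨evalOne t, smul_evalOne t⟩ p₀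
    have ht : t = ofFixed A (evalOne t) (smul_evalOne t) :=
      evalOne_injective (evalOne_ofFixed _ _ _).symm
    refine Eq.trans ?_ (h.trans ?_)
    · exact congrArg (fun t => (QuotientAddGroup.mk (basisElt t) : N)) ht
    · rw [AddMonoidHom.comp_apply]
      refine Eq.trans ?_ (congrArg _ (augmentation_basisElt t).symm)
      exact (one_zsmul _).symm
  have hx' : (QuotientAddGroup.mk' B) x = 0 := by
    rw [key, AddMonoidHom.comp_apply]
    refine (congrArg _ hx).trans (map_zero _)
  exact (QuotientAddGroup.eq_zero_iff x).1 hx'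

/-- The class of a pair in the cokernel of the boundary is a tautological 1-cocycle. A primitive of
it, given by `h₁`, factors the quotient map through the boundary of 1-chains, so 1-cycles have class
zero. -/
theorem orderBoundaryTwo_exact
    (h₁ : ∀ K ∈ F, ∀ (N : Type u) [AddCommGroup N] (α : FixedElts V K → FixedElts V K → N),
      (∀ p q r, p ≤ q → q ≤ r → α p q + α q r = α p r) →
        ∃ v : FixedElts V K → N, ∀ p q, p ≤ q → α p q = v q - v p) :
    (ShortComplex.mk _ _ (orderBoundaryTwo_comp (F := F) (V := V))).Exact := by
  classical
  refine exact_of_app _ fun A x hx => ?_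
  change (orderBoundaryOne G F V).app A x = 0 at hx
  let B := ((orderBoundaryTwo G F V).app A).hom.range
  let N := (permModule F (LEPairs V)).obj A ⧸ B
  let e : ∀ p q : FixedElts V A.unop.subgroup, p ≤ q → (permModule F (LEPairs V)).obj A :=
    fun p q hpq => basisElt (ofFixed A ⟨(p.1, q.1), hpq⟩ fun k hk => Subtype.ext
      (Prod.ext (p.2 k hk) (q.2 k hk)))
  -- The value on incomparable pairs is arbitrary: the cocycle and coboundary conditions only see
  -- comparable ones.
  let α : FixedElts V A.unop.subgroup → FixedElts V A.unop.subgroup → N := fun p q =>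
    if h : p ≤ q then QuotientAddGroup.mk (e p q h) else 0
  have hα' : ∀ p q (h : p ≤ q), α p q = QuotientAddGroup.mk (e p q h) := fun p q h => dif_pos h
  have hα : ∀ p q r, p ≤ q → q ≤ r → α p q + α q r = α p r := by
    intro p q r hpq hqr
    rw [hα' p q hpq, hα' q r hqr, hα' p r (hpq.trans hqr)]
    refine Eq.symm (QuotientAddGroup.eq.2 ?_)
    refine ⟨basisElt (ofFixed A ⟨(p.1, q.1, r.1), hpq, hqr⟩ fun k hk => Subtype.ext
      (Prod.ext (p.2 k hk) (Prod.ext (q.2 k hk) (r.2 k hk)))), ?_⟩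
    refine (orderBoundaryTwo_basisElt _).trans ?_
    rw [postcomp_ofFixed, postcomp_ofFixed, postcomp_ofFixed]
    change e q r hqr - e p r (hpq.trans hqr) + e p q hpq =
      -e p r (hpq.trans hqr) + (e p q hpq + e q r hqr)
    rw [sub_eq_neg_add, add_assoc, add_comm (e q r hqr)]
  obtain ⟨v, hv⟩ := h₁ _ A.unop.mem N α hα
  have key : (QuotientAddGroup.mk' B) =
      (freeAddLift (T := homPresheaf F V) fun t => v ⟨evalOne t, smul_evalOne t⟩).comp
        ((orderBoundaryOne G F V).app A).hom := by
    refine freeModule_addHom_ext fun t => ?_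
    rw [AddMonoidHom.comp_apply]
    refine Eq.trans ?_ (congrArg _ (orderBoundaryOne_basisElt t).symm)
    rw [map_sub, freeAddLift_basisElt, freeAddLift_basisElt]
    refine Eq.trans ?_ (hv _ _ (evalOne t).2)
    rw [hα' _ _ (evalOne t).2]
    refine congrArg (fun t => (QuotientAddGroup.mk (basisElt t) : N)) ?_
    exact evalOne_injective (evalOne_ofFixed _ _ _).symm
  have hx' : (QuotientAddGroup.mk' B) x = 0 := by
    rw [key, AddMonoidHom.comp_apply]
    refine (congrArg _ hx).trans (map_zero _)
  exact (QuotientAddGroup.eq_zero_iff x).1 hx'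

/-- A group acting monotonically and with finitely many orbits on a preorder with finite
lower sets, isotropy in `F` and fixed point sets that are connected and have trivial first
cohomology, is of type `FP₂` relative to `F`. -/
theorem isTypeFP_two_of_preorder (hstab : ∀ v : V, MulAction.stabilizer G v ∈ F)
    (V₀ : Set V) (hV₀ : V₀.Finite) (hcover : ∀ v : V, ∃ g : G, ∃ w ∈ V₀, g • w = v)
    (hfin : ∀ v : V, {w | w ≤ v}.Finite) (hne : ∀ K ∈ F, Nonempty (FixedElts V K))
    (h₀ : ∀ K ∈ F, ∀ (N : Type u) (v : FixedElts V K → N), (∀ p q, p ≤ q → v p = v q) →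
      ∀ p q, v p = v q)
    (h₁ : ∀ K ∈ F, ∀ (N : Type u) [AddCommGroup N] (α : FixedElts V K → FixedElts V K → N),
      (∀ p q r, p ≤ q → q ≤ r → α p q + α q r = α p r) →
        ∃ v : FixedElts V K → N, ∀ p q, p ≤ q → α p q = v q - v p) : IsTypeFP 2 F := by
  have hstab₁ : ∀ p : LEPairs V, MulAction.stabilizer G p ∈ F := fun p =>
    F.le_mem' _ (hstab p.1.1) _ fun g hg => congrArg (fun p : LEPairs V => p.1.1) hg
  have hstab₂ : ∀ p : LETriples V, MulAction.stabilizer G p ∈ F := fun p =>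
    F.le_mem' _ (hstab p.1.1) _ fun g hg => congrArg (fun p : LETriples V => p.1.1) hg
  have hlow : (⋃ v ∈ V₀, {w | w ≤ v}).Finite := hV₀.biUnion fun v _ => hfin v
  -- Translating the top of a chain into `V₀` moves the whole chain into this finite set, so there
  -- are finitely many orbits of chains.
  set D := ⋃ v ∈ V₀, {w | w ≤ v}
  have hD : ∀ v ∈ V₀, ∀ w ≤ v, w ∈ D := fun v hv w hw => Set.mem_biUnion hv hw
  have := projective_permModule V hstab
  have := projective_permModule (LEPairs V) hstab₁
  have := projective_permModule (LETriples V) hstab₂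
  have := augmentation_epi (F := F) (S := V) hne
  obtain ⟨P, hP⟩ := exists_projectiveResolution _ _ (orderBoundaryTwo_comp (F := F) (V := V))
    (augmentation F V) orderBoundaryOne_comp (orderBoundaryOne_exact h₀ hne)
    (orderBoundaryTwo_exact h₁)
  refine ⟨P, fun i hi => ?_⟩
  rw [hP]
  match i, hi with
  | 0, _ => exact isFinitelyGenerated_permModule V hstab V₀ hV₀ hcover
  | 1, _ =>
    refine isFinitelyGenerated_permModule (LEPairs V) hstab₁ {p | p.1 ∈ D ×ˢ D}
      ((hlow.prod hlow).preimage Subtype.val_injective.injOn) ?_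
    rintro ⟨⟨a, b⟩, hab⟩
    obtain ⟨g, w, hw, rfl⟩ := hcover b
    have ha : g⁻¹ • a ≤ w := by
      have := IsMonotoneAction.smul_le_smul g⁻¹ hab
      rwa [inv_smul_smul] at this
    exact ⟨g, ⟨(g⁻¹ • a, w), ha⟩, ⟨hD w hw _ ha, hD w hw _ le_rfl⟩,
      Subtype.ext (Prod.ext (smul_inv_smul g a) rfl)⟩
  | 2, _ =>
    refine isFinitelyGenerated_permModule (LETriples V) hstab₂ {p | p.1 ∈ D ×ˢ D ×ˢ D}
      ((hlow.prod (hlow.prod hlow)).preimage Subtype.val_injective.injOn) ?_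
    rintro ⟨⟨a, b, c⟩, hab, hbc⟩
    obtain ⟨g, w, hw, rfl⟩ := hcover c
    have hb : g⁻¹ • b ≤ w := by
      have := IsMonotoneAction.smul_le_smul g⁻¹ hbc
      rwa [inv_smul_smul] at this
    have ha := IsMonotoneAction.smul_le_smul g⁻¹ hab
    exact ⟨g, ⟨(g⁻¹ • a, g⁻¹ • b, w), ha, hb⟩,
      ⟨hD w hw _ (ha.trans hb), hD w hw _ hb, hD w hw _ le_rfl⟩,
      Subtype.ext (Prod.ext (smul_inv_smul g a) (Prod.ext (smul_inv_smul g b) rfl))⟩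

end Chains

end BredonModule

/-! ### The preorder of cells of a cocompact model -/

section Model

open Topology.RelCWComplex OpenCells

variable {G : Type u} [Group G] {F : SubgroupFamily G}

instance {X : Type u} [TopologicalSpace X] [CWComplex (Set.univ : Set X)] [MulAction G X]
    [MulAction G (OpenCells X)] [IsCellAction G X] :
    BredonModule.IsMonotoneAction G (OpenCells X) :=
  ⟨fun g => smul_le_smul g⟩

/-- A group with a cocompact model for the classifying space is of type `FP₂`. -/
theorem HasCocompactModel.isTypeFP_two (h : HasCocompactModel F) : IsTypeFP 2 F := by
  obtain ⟨X, _, _, _, _, hX, T, hT⟩ := h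
  let _ := OpenCells.mulAction hX.isGComplex
  have := OpenCells.isCellAction hX.isGComplex
  let cl : (Σ n : ℕ, cell (Set.univ : Set X) n) → OpenCells X :=
    fun c => ⟨openCell c.1 c.2, c.1, c.2, rfl⟩
  refine BredonModule.isTypeFP_two_of_preorder (V := OpenCells X) (fun e => ?_) (cl '' T)
    (T.finite_toSet.image cl) ?_ OpenCells.finite_Iic (fun K hK => ?_) (fun K hK N v hv => ?_)
    (fun K hK N _ α hα => ?_)
  · obtain ⟨x, hx⟩ := e.nonempty
    rw [stabilizer_eq_of_mem hx]
    exact hX.stabilizer_mem x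
  · rintro ⟨_, n, i, rfl⟩
    obtain ⟨g, j, hj, h⟩ := hT n i
    exact ⟨g, _, ⟨⟨n, j⟩, hj, rfl⟩, Subtype.ext h⟩
  · have := hX.contractible_fixedPoints K hK
    obtain ⟨y⟩ : Nonempty (MulAction.fixedPoints K X) := inferInstance
    exact ⟨fixedCellOf K y⟩
  · have := hX.contractible_fixedPoints K hK
    exact eq_of_le_imp_eq_of_isOpen_star (fixedCellOf_surjective K) (isOpen_fixed_star K) v hv
  · have := hX.contractible_fixedPoints K hK
    exact exists_coboundary_of_contractibleSpace (fixedCellOf_surjective K) (isOpen_fixed_star K)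
      (isPreconnected_fixed_star K) α hα

end Model

/-! ### Norm estimates -/

section Norms

/-- A subadditive symmetric length function on an abelian group. -/
structure IsLength {N : Type*} [AddCommGroup N] (ℓ : N → ℕ∞) : Prop where
  map_zero : ℓ 0 = 0
  add_le : ∀ x y, ℓ (x + y) ≤ ℓ x + ℓ y
  neg_le : ∀ x, ℓ (-x) ≤ ℓ x

variable {N : Type*} [AddCommGroup N] {ℓ : N → ℕ∞}

theorem IsLength.nsmul_le (h : IsLength ℓ) (n : ℕ) (x : N) : ℓ (n • x) ≤ n * ℓ x := by
  induction n with
  | zero => simp [h.map_zero]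
  | succ n ih =>
    rw [succ_nsmul, Nat.cast_succ, add_mul, one_mul]
    exact (h.add_le _ _).trans (add_le_add_left ih _)

theorem IsLength.zsmul_le (h : IsLength ℓ) (n : ℤ) (x : N) : ℓ (n • x) ≤ n.natAbs * ℓ x := by
  obtain ⟨m, rfl | rfl⟩ := n.eq_nat_or_neg
  · simpa using h.nsmul_le m x
  · rw [neg_zsmul, natCast_zsmul, Int.natAbs_neg, Int.natAbs_natCast]
    exact (h.neg_le _).trans (h.nsmul_le m x)

theorem IsLength.sum_le (h : IsLength ℓ) {ι : Type*} (x : ι →₀ ℤ) (m : ι → N) (C : ℕ∞)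
    (hC : ∀ i ∈ x.support, ℓ (m i) ≤ C) :
    ℓ (x.sum fun i n => n • m i) ≤ C * (x.sum fun _ n => n.natAbs : ℕ) := by
  have key : ∀ s : Finset ι, (∀ i ∈ s, ℓ (m i) ≤ C) →
      ℓ (∑ i ∈ s, x i • m i) ≤ C * (∑ i ∈ s, (x i).natAbs : ℕ) := by
    classical
    intro s
    induction s using Finset.induction_on with
    | empty => simp [h.map_zero]
    | insert i s hi ih =>
      intro hs
      rw [Finset.sum_insert hi, Finset.sum_insert hi, Nat.cast_add, mul_add]
      refine (h.add_le _ _).trans (add_le_add ?_ (ih fun j hj => hs j (Finset.mem_insert_of_mem hj)))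
      refine (h.zsmul_le _ _).trans ?_
      rw [mul_comm]
      exact mul_le_mul_left (hs i (Finset.mem_insert_self i s)) _
  exact key x.support hC

theorem exists_nat_bound {ι : Type*} [Finite ι] (f : ι → ℕ∞) (hf : ∀ i, f i ≠ ⊤) :
    ∃ C : ℕ, ∀ i, f i ≤ C := by
  choose c hc using fun i => ENat.ne_top_iff_exists.1 (hf i)
  obtain ⟨C, hC⟩ := Finite.exists_le c
  exact ⟨C, fun i => by rw [← hc i]; exact_mod_cast hC i⟩

/-- The `ℓ₁`-norm of a finitely supported integral function. -/
def finsuppNorm {ι : Type*} (x : ι →₀ ℤ) : ℕ := x.sum fun _ n => n.natAbs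

theorem finsuppNorm_add_le {ι : Type*} (x y : ι →₀ ℤ) :
    finsuppNorm (x + y) ≤ finsuppNorm x + finsuppNorm y := by
  classical
  unfold finsuppNorm
  rw [Finsupp.sum_of_support_subset (x + y) (s := x.support ∪ y.support) Finsupp.support_add _
    (by simp), Finsupp.sum_of_support_subset x (s := x.support ∪ y.support)
    Finset.subset_union_left _ (by simp), Finsupp.sum_of_support_subset y
    (s := x.support ∪ y.support) Finset.subset_union_right _ (by simp), ← Finset.sum_add_distrib]
  exact Finset.sum_le_sum fun i _ => Int.natAbs_add_le _ _

theorem finsuppNorm_neg {ι : Type*} (x : ι →₀ ℤ) : finsuppNorm (-x) = finsuppNorm x := by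
  unfold finsuppNorm
  rw [Finsupp.sum_neg_index (by simp)]
  simp

theorem isLength_finsuppNorm {ι : Type*} : IsLength fun x : ι →₀ ℤ => (finsuppNorm x : ℕ∞) where
  map_zero := by simp [finsuppNorm]
  add_le x y := by exact_mod_cast finsuppNorm_add_le x y
  neg_le x := by rw [finsuppNorm_neg]

theorem finsuppNorm_mapDomain_le {ι κ : Type*} (f : ι → κ) (x : ι →₀ ℤ) :
    finsuppNorm (x.mapDomain f) ≤ finsuppNorm x := by
  have h := isLength_finsuppNorm.sum_le x (fun i => Finsupp.single (f i) 1) 1 fun i _ => by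
    simp [finsuppNorm]
  rw [one_mul] at h
  have h' : x.mapDomain f = x.sum fun i n => n • Finsupp.single (f i) 1 := by
    simp [Finsupp.mapDomain]
  rw [h']
  exact_mod_cast h

end Norms

/-! ### Filling norms and boundedness of equivariant maps -/

section FillingNormEstimates

variable {G : Type u} [Group G] {M : Type u} [AddCommGroup M] [DistribMulAction G M] {n : ℕ}
  {b : Fin n → M}

theorem freeMap_eq_sum (x : Fin n × G →₀ ℤ) :
    freeMap b x = x.sum fun p c => c • p.2 • b p.1 := rfl

theorem fillingNorm_le {x : Fin n × G →₀ ℤ} {m : M} (h : freeMap b x = m) :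
    fillingNorm G b m ≤ finsuppNorm x :=
  iInf₂_le x h

theorem exists_of_fillingNorm_le {m : M} {k : ℕ} (h : fillingNorm G b m ≤ k) :
    ∃ x : Fin n × G →₀ ℤ, freeMap b x = m ∧ finsuppNorm x ≤ k := by
  -- A strict bound on the infimum yields a witness, and integrality brings `k + 1` back to `k`.
  have h' : fillingNorm G b m < (k + 1 : ℕ) := h.trans_lt (by exact_mod_cast Nat.lt_succ_self k)
  unfold fillingNorm at h'
  simp only [iInf_lt_iff] at h'
  obtain ⟨x, hx, h⟩ := h'
  exact ⟨x, hx, Nat.lt_succ_iff.1 (by exact_mod_cast h)⟩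

theorem fillingNorm_ne_top (hb : Generates G b) (m : M) : fillingNorm G b m ≠ ⊤ := by
  obtain ⟨x, hx⟩ := hb m
  exact ((fillingNorm_le hx).trans_lt (ENat.natCast_lt_top _)).ne

theorem isLength_fillingNorm (hb : Generates G b) : IsLength (fillingNorm G b) := by
  have key : ∀ m, ∃ x : Fin n × G →₀ ℤ, freeMap b x = m ∧ (finsuppNorm x : ℕ∞) = fillingNorm G b m := by
    intro m
    obtain ⟨k, hk⟩ := ENat.ne_top_iff_exists.1 (fillingNorm_ne_top hb m)
    obtain ⟨x, hx, hx'⟩ := exists_of_fillingNorm_le hk.ge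
    refine ⟨x, hx, le_antisymm ?_ (fillingNorm_le hx)⟩
    rw [← hk]
    exact_mod_cast hx'
  refine ⟨?_, fun m m' => ?_, fun m => ?_⟩
  · have h := fillingNorm_le (G := G) (b := b) (map_zero (freeMap b))
    simpa [finsuppNorm] using h
  · obtain ⟨x, hx, h⟩ := key m
    obtain ⟨x', hx', h'⟩ := key m'
    rw [← h, ← h']
    refine (fillingNorm_le (x := x + x') (by rw [map_add, hx, hx'])).trans ?_
    exact_mod_cast finsuppNorm_add_le x x'
  · obtain ⟨x, hx, h⟩ := key m
    rw [← h, ← finsuppNorm_neg]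
    exact fillingNorm_le (by rw [map_neg, hx])

theorem smul_freeMap (g : G) (x : Fin n × G →₀ ℤ) :
    g • freeMap b x = freeMap b (x.mapDomain fun p => (p.1, g * p.2)) := by
  rw [freeMap_eq_sum, freeMap_eq_sum, Finsupp.sum_mapDomain_index (by simp)
    (by intros; rw [add_smul]), Finsupp.smul_sum]
  refine Finsupp.sum_congr fun p _ => ?_
  rw [mul_smul]
  exact map_zsmul (DistribSMul.toAddMonoidHom M g) _ _

theorem fillingNorm_smul_le (g : G) (m : M) : fillingNorm G b (g • m) ≤ fillingNorm G b m := by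
  refine le_iInf₂ fun x hx => ?_
  refine (fillingNorm_le (x := x.mapDomain fun p => (p.1, g * p.2)) ?_).trans ?_
  · rw [← smul_freeMap, hx]
  · exact_mod_cast finsuppNorm_mapDomain_le _ x

/-- An additive map that is bounded on the translates of the generators is bounded. -/
theorem IsLength.map_le_of_fillingNorm_le {N : Type*} [AddCommGroup N] {ℓ : N → ℕ∞}
    (hℓ : IsLength ℓ) (φ : M →+ N) {C : ℕ∞} (hC : ∀ (g : G) (i : Fin n), ℓ (φ (g • b i)) ≤ C)
    {m : M} {k : ℕ} (hm : fillingNorm G b m ≤ k) : ℓ (φ m) ≤ C * k := by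
  obtain ⟨x, rfl, hx⟩ := exists_of_fillingNorm_le hm
  rw [freeMap_eq_sum, map_finsuppSum]
  simp only [map_zsmul]
  refine (hℓ.sum_le x (fun p => φ (p.2 • b p.1)) C fun p _ => hC p.2 p.1).trans ?_
  gcongr
  exact hx

/-- An equivariant additive map out of a finitely generated module is bounded. -/
theorem IsLength.exists_bound {G' : Type*} [Group G'] {N : Type*} [AddCommGroup N]
    [DistribMulAction G' N] {ℓ : N → ℕ∞} (hℓ : IsLength ℓ) (hsmul : ∀ (g : G') (x : N), ℓ (g • x) ≤ ℓ x)
    (htop : ∀ x, ℓ x ≠ ⊤) (ρ : G → G') (φ : M →+ N) (hφ : ∀ (g : G) (m : M), φ (g • m) = ρ g • φ m)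
    (b : Fin n → M) :
    ∃ C : ℕ, ∀ (m : M) (k : ℕ), fillingNorm G b m ≤ k → ℓ (φ m) ≤ (C * k : ℕ) := by
  obtain ⟨C, hC⟩ := exists_nat_bound (fun i => ℓ (φ (b i))) fun i => htop _
  refine ⟨C, fun m k hm => ?_⟩
  rw [Nat.cast_mul]
  refine hℓ.map_le_of_fillingNorm_le φ (fun g i => ?_) hm
  rw [hφ]
  exact (hsmul _ _).trans (hC i)

end FillingNormEstimates

/-! ### Comparison of resolutions of a group and a subgroup -/

namespace BredonModule

open Opposite OrbitCategory

variable {G : Type u} [Group G] {F : SubgroupFamily G}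

theorem app_smul {M N : BredonModule F} (f : M ⟶ N) (g : G) (x : M.component) :
    f.app _ (g • x : M.component) = (g • (f.app _ x : N.component) : N.component) :=
  congrArg (fun k => k x) (f.naturality (rightMul g).op)

/-! ### The component at H/1 of a restricted module -/

section Base

variable (F) (H : Subgroup G)

/-- The isomorphism from `G/1` to the object induced from `H/1`. -/
def baseHom : base F ⟶ (induction F H).obj (base (F.inter H)) :=
  quotientHom ⊥ ((1 : G) : G ⧸ (⊥ : Subgroup H).map H.subtype) fun k hk => by
    obtain rfl : k = 1 := Subgroup.mem_bot.1 hk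
    exact one_smul G _

/-- The inverse of `baseHom`. -/
def baseInv : (induction F H).obj (base (F.inter H)) ⟶ base F :=
  quotientHom ((⊥ : Subgroup H).map H.subtype) ((1 : G) : G ⧸ (⊥ : Subgroup G)) fun k hk => by
    rw [Subgroup.map_bot, Subgroup.mem_bot] at hk
    subst hk
    exact one_smul G _

theorem baseHom_baseInv : baseHom F H ≫ baseInv F H = 𝟙 _ :=
  quotientHom_ext (by
    change ((1 : G) * 1) • ((1 : G) : G ⧸ (⊥ : Subgroup G)) = _
    rw [mul_one, one_smul]
    rfl)

theorem baseInv_baseHom : baseInv F H ≫ baseHom F H = 𝟙 _ :=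
  quotientHom_ext (by
    change ((1 : G) * 1) • ((1 : G) : G ⧸ (⊥ : Subgroup H).map H.subtype) = _
    rw [mul_one, one_smul]
    rfl)

theorem baseHom_rightMul (h : H) :
    baseHom F H ≫ (induction F H).map (rightMul h) = rightMul (h : G) ≫ baseHom F H :=
  quotientHom_ext (by
    change MulActionHom.toFun ((induction F H).map (rightMul h))
      ((1 : G) • ((1 : G) : G ⧸ (⊥ : Subgroup H).map H.subtype)) =
      ((1 : G) * h) • ((1 : G) : G ⧸ (⊥ : Subgroup H).map H.subtype)
    rw [one_smul]
    refine (induction_map_one F H (rightMul h) h ?_).trans ?_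
    · exact congrArg QuotientGroup.mk (one_mul h)
    · exact congrArg QuotientGroup.mk (by simp))

variable {F}

/-- The identification of the component at `H/1` of a restricted module. -/
def toComponent (M : BredonModule F) :
    BredonModule.component ((restriction F H).obj M) →+ M.component :=
  (M.map (baseHom F H).op).hom

/-- The inverse of `toComponent`. -/
def ofComponent (M : BredonModule F) :
    M.component →+ BredonModule.component ((restriction F H).obj M) :=
  (M.map (baseInv F H).op).hom

variable {H}

theorem ofComponent_toComponent (M : BredonModule F)
    (x : BredonModule.component ((restriction F H).obj M)) :
    ofComponent H M (toComponent H M x) = x := by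
  change M.map (baseInv F H).op (M.map (baseHom F H).op x) = x
  rw [← AddCommGrpCat.comp_apply, ← M.map_comp, ← op_comp, baseInv_baseHom]
  simp

theorem toComponent_ofComponent (M : BredonModule F) (x : M.component) :
    toComponent H M (ofComponent H M x) = x := by
  change M.map (baseHom F H).op (M.map (baseInv F H).op x) = x
  rw [← AddCommGrpCat.comp_apply, ← M.map_comp, ← op_comp, baseHom_baseInv]
  simp

theorem toComponent_smul (M : BredonModule F) (h : H)
    (x : BredonModule.component ((restriction F H).obj M)) :
    toComponent H M (h • x) = (h : G) • toComponent H M x := by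
  change M.map (baseHom F H).op (M.map ((induction F H).map (rightMul h)).op x) =
    M.map (rightMul (h : G)).op (M.map (baseHom F H).op x)
  rw [← AddCommGrpCat.comp_apply, ← M.map_comp, ← op_comp, baseHom_rightMul, op_comp, M.map_comp,
    AddCommGrpCat.comp_apply]

theorem ofComponent_smul (M : BredonModule F) (h : H) (x : M.component) :
    ofComponent H M ((h : G) • x) = h • ofComponent H M x := by
  conv_lhs => rw [← toComponent_ofComponent (H := H) M x]
  rw [← toComponent_smul, ofComponent_toComponent]

theorem toComponent_app {M N : BredonModule F} (f : M ⟶ N)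
    (x : BredonModule.component ((restriction F H).obj M)) :
    toComponent H N (((restriction F H).map f).app _ x) = f.app _ (toComponent H M x) :=
  (congrArg (fun k => k x) (f.naturality (baseHom F H).op)).symm

end Base

theorem app_comm {C D : ChainComplex (BredonModule F) ℕ} (f : C ⟶ D) (i j : ℕ)
    (A : (OrbitCategory F)ᵒᵖ) (x : (C.X i).obj A) :
    (D.d i j).app A ((f.f i).app A x) = (f.f j).app A ((C.d i j).app A x) :=
  congrArg (fun k => k.app A x) (f.comm i j)

theorem lift_id_comp_π (P P' : ProjectiveResolution (trivialZ F)) :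
    ProjectiveResolution.lift (𝟙 _) P P' ≫ P'.π = P.π := by
  have h := ProjectiveResolution.lift_commutes (𝟙 (trivialZ F)) P P'
  rwa [CategoryTheory.Functor.map_id, Category.comp_id] at h

theorem map_comp_map_comp {C D : Type*} [Category* C] [Category* D] (Φ : C ⥤ D) {X Y Z : C}
    {f : X ⟶ Y} {g : Y ⟶ Z} {k : X ⟶ Z} (h : f ≫ g = k) {W : D} (t : Φ.obj Z ⟶ W) :
    Φ.map f ≫ Φ.map g ≫ t = Φ.map k ≫ t := by
  rw [← Category.assoc, ← Functor.map_comp, h]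

theorem restriction_lift_comp_π (H : Subgroup G) (P P' : ProjectiveResolution (trivialZ F)) :
    ((restriction F H).mapHomologicalComplex _).map (ProjectiveResolution.lift (𝟙 _) P P') ≫
      (restrictResolution H P').π = (restrictResolution H P).π :=
  map_comp_map_comp _ (lift_id_comp_π P P') _

/-- This is where dimension two enters: fillings of 1-cycles become unique. -/
theorem resolutionBoundary_injective_of_isZero (P : ProjectiveResolution (trivialZ F))
    (hP : Limits.IsZero (P.complex.X 3)) : Function.Injective (resolutionBoundary P 1) := by
  rw [injective_iff_map_eq_zero]
  intro x hx
  obtain ⟨y, hy⟩ := app_exact _ (P.exact_succ 1) _ x hx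
  have h0 : P.complex.d 3 2 = 0 := hP.eq_of_src _ _
  rw [← hy]
  change (P.complex.d 3 2).app _ y = 0
  rw [h0]
  rfl

theorem exists_resolutionBoundary_eq (P : ProjectiveResolution (trivialZ F))
    (γ : resolutionComponent P 1) (hγ : resolutionBoundary P 0 γ = 0) :
    ∃ ν, resolutionBoundary P 1 ν = γ :=
  app_exact _ (P.exact_succ 0) _ γ hγ

/-- Comparison of a resolution for a subgroup with a resolution for the group that has length two. -/
theorem exists_comparison (H : Subgroup G) (Q : ProjectiveResolution (trivialZ (F.inter H)))
    (P P' : ProjectiveResolution (trivialZ F)) (hP' : Limits.IsZero (P'.complex.X 3)) :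
    ∃ (J : Type u) (A : J → OrbitCategory F)
      (a : resolutionComponent Q 1 →+ resolutionComponent P 1)
      (w : resolutionComponent P 2 →+ (freeModule (sumRep A)).component)
      (c : resolutionComponent Q 2 →+ (freeModule (sumRep A)).component)
      (r : (freeModule (sumRep A)).component →+ resolutionComponent Q 2)
      (s : resolutionComponent Q 1 →+ resolutionComponent Q 2),
      (∀ (h : H) x, a (h • x) = (h : G) • a x) ∧ (∀ (g : G) x, w (g • x) = g • w x) ∧
      (∀ (h : H) x, c (h • x) = (h : G) • c x) ∧ (∀ (h : H) x, r ((h : G) • x) = h • r x) ∧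
      (∀ (h : H) x, s (h • x) = h • s x) ∧
      (∀ γ, resolutionBoundary Q 0 γ = 0 → resolutionBoundary P 0 (a γ) = 0) ∧
      ∀ γ ν μ, resolutionBoundary Q 0 γ = 0 → resolutionBoundary Q 1 ν = γ →
        resolutionBoundary P 1 μ = a γ →
          w μ = c ν ∧ resolutionBoundary Q 1 (r (c ν) - s γ) = γ := by
  -- The module in degree two of `P'` need not be finitely generated and has no filling norm; inside
  -- a free module it inherits an ℓ₁-norm.
  obtain ⟨J, A, i, p, hip⟩ := exists_retract_sumRep (P'.complex.X 2)
  let α : Q.complex ⟶ (restrictResolution H P).complex := ProjectiveResolution.lift (𝟙 _) _ _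
  let β : P.complex ⟶ P'.complex := ProjectiveResolution.lift (𝟙 _) _ _
  let Rβ : (restrictResolution H P).complex ⟶ (restrictResolution H P').complex :=
    ((restriction F H).mapHomologicalComplex _).map β
  let δ : (restrictResolution H P').complex ⟶ Q.complex := ProjectiveResolution.lift (𝟙 _) _ _
  have hα : α ≫ (restrictResolution H P).π = Q.π := lift_id_comp_π _ _
  have hβ : Rβ ≫ (restrictResolution H P').π = (restrictResolution H P).π :=
    restriction_lift_comp_π H P P'
  have hδ : δ ≫ Q.π = (restrictResolution H P').π := lift_id_comp_π _ _
  -- Both chain maps lift the identity of the trivial module.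
  let η : Homotopy (α ≫ Rβ ≫ δ) (𝟙 Q.complex) :=
    ProjectiveResolution.liftHomotopy (𝟙 _) _ _
      (by rw [CategoryTheory.Functor.map_id, Category.comp_id, Category.assoc, Category.assoc, hδ,
        hβ, hα])
      (by rw [CategoryTheory.Functor.map_id, Category.comp_id, Category.id_comp])
  let B : (OrbitCategory (F.inter H))ᵒᵖ := op (base (F.inter H))
  let a : resolutionComponent Q 1 →+ resolutionComponent P 1 :=
    (toComponent H (P.complex.X 1)).comp ((α.f 1).app B).hom
  let w : resolutionComponent P 2 →+ (freeModule (sumRep A)).component :=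
    ((β.f 2 ≫ i).app (op (base F))).hom
  let c : resolutionComponent Q 2 →+ (freeModule (sumRep A)).component :=
    (toComponent H _).comp (((α ≫ Rβ).f 2 ≫ (restriction F H).map i).app B).hom
  let r : (freeModule (sumRep A)).component →+ resolutionComponent Q 2 :=
    (((restriction F H).map p ≫ δ.f 2).app B).hom.comp (ofComponent H _)
  let s : resolutionComponent Q 1 →+ resolutionComponent Q 2 := ((η.hom 1 2).app B).hom
  refine ⟨J, A, a, w, c, r, s, fun h x => ?_, fun g x => ?_, fun h x => ?_, fun h x => ?_,
    fun h x => ?_, fun γ hγ => ?_, fun γ ν μ hγ hν hμ => ?_⟩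
  · exact (congrArg (toComponent H _) (app_smul (α.f 1) h x)).trans (toComponent_smul _ h _)
  · exact app_smul _ g x
  · exact (congrArg (toComponent H _) (app_smul ((α ≫ Rβ).f 2 ≫ (restriction F H).map i) h x)).trans
      (toComponent_smul _ h _)
  · exact (congrArg (((restriction F H).map p ≫ δ.f 2).app B) (ofComponent_smul _ h x)).trans
      (app_smul _ h _)
  · exact app_smul _ h x
  · refine (toComponent_app (P.complex.d 1 0) _).symm.trans ?_
    refine (congrArg (toComponent H _) (app_comm α 1 0 B γ)).trans ?_
    refine (congrArg (fun y => toComponent H _ ((α.f 0).app B y)) hγ).trans ?_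
    exact (congrArg (toComponent H _) (map_zero ((α.f 0).app B).hom)).trans (map_zero _)
  -- Both sides have as boundary the image of `γ` in `P'`, and fillings there are unique.
  · have h₁ : (β.f 2).app _ μ = toComponent H _ (((α ≫ Rβ).f 2).app B ν) := by
      refine resolutionBoundary_injective_of_isZero P' hP' ?_
      refine (app_comm β 2 1 _ μ).trans ?_
      refine (congrArg ((β.f 1).app _) hμ).trans ?_
      refine Eq.trans ?_ (toComponent_app (P'.complex.d 2 1) _)
      refine (toComponent_app (β.f 1) _).symm.trans ?_
      refine congrArg (toComponent H _) ?_
      refine Eq.trans ?_ (app_comm (α ≫ Rβ) 2 1 B ν).symm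
      exact (congrArg (((α ≫ Rβ).f 1).app B) hν).symm
    constructor
    · refine (congrArg (i.app _) h₁).trans ?_
      exact (toComponent_app i _).symm
    · have h₂ : r (c ν) = ((α ≫ Rβ ≫ δ).f 2).app B ν := by
        refine (congrArg (((restriction F H).map p ≫ δ.f 2).app B)
          (ofComponent_toComponent _ _)).trans ?_
        have h : (restriction F H).map i ≫ (restriction F H).map p = 𝟙 _ := by
          rw [← Functor.map_comp, hip, CategoryTheory.Functor.map_id]
        exact congrArg (fun k => (δ.f 2).app B (k.app B (((α ≫ Rβ).f 2).app B ν))) h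
      -- The homotopy formula in degree one; the term through degree zero vanishes because `γ` is a
      -- cycle.
      have h₃ : ((α ≫ Rβ ≫ δ).f 1).app B γ = resolutionBoundary Q 1 (s γ) + γ := by
        have h := η.comm 1
        rw [Homotopy.dNext_succ_chainComplex, Homotopy.prevD_chainComplex] at h
        refine (congrArg (fun k => k.app B γ) h).trans ?_
        have h0 : (η.hom 0 1).app B ((Q.complex.d 1 0).app B γ) = 0 :=
          (congrArg ((η.hom 0 1).app B) hγ).trans (map_zero ((η.hom 0 1).app B).hom)
        change (η.hom 0 1).app B ((Q.complex.d 1 0).app B γ) + (Q.complex.d 2 1).app B (s γ) + γ = _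
        rw [h0]
        exact congrArg (· + γ) (zero_add (resolutionBoundary Q 1 (s γ)))
      rw [map_sub, h₂]
      refine (congrArg (· - _) (app_comm (α ≫ Rβ ≫ δ) 2 1 B ν)).trans ?_
      refine (congrArg (fun y => ((α ≫ Rβ ≫ δ).f 1).app B y - _) hν).trans ?_
      refine (congrArg (· - _) h₃).trans ?_
      exact add_sub_cancel_left _ _

end BredonModule

/-! ### The filling function of a subgroup -/

section Subgroup

open BredonModule Opposite OrbitCategory

variable {G : Type u} [Group G] {F : SubgroupFamily G}

/-! ### The ℓ₁-norm and supports in free modules -/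

section FreeNorm

variable {T : (OrbitCategory F)ᵒᵖ ⥤ Type u}

/-- The `ℓ₁`-norm on the component at `G/1` of a free module. -/
noncomputable def freeNorm (x : (freeModule T).component) : ℕ∞ :=
  (finsuppNorm (show T.obj (op (base F)) →₀ ℤ from x) : ℕ∞)

theorem isLength_freeNorm : IsLength (freeNorm (T := T)) :=
  isLength_finsuppNorm (ι := T.obj (op (base F)))

theorem freeNorm_ne_top (x : (freeModule T).component) : freeNorm x ≠ ⊤ := ENat.natCast_ne_top _

theorem freeNorm_smul_le (g : G) (x : (freeModule T).component) :
    freeNorm (g • x) ≤ freeNorm x := by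
  unfold freeNorm
  exact_mod_cast finsuppNorm_mapDomain_le (T.map (rightMul g).op)
    (show T.obj (op (base F)) →₀ ℤ from x)

/-- The elements of a free module that are supported in a given subset of the basis. -/
def supportedSubgroup (s : Set (T.obj (op (base F)))) : AddSubgroup (freeModule T).component where
  carrier := {x | ∀ t, (show T.obj (op (base F)) →₀ ℤ from x) t ≠ 0 → t ∈ s}
  zero_mem' t ht := (ht rfl).elim
  add_mem' {x y} hx hy t ht := by
    by_cases h : (show T.obj (op (base F)) →₀ ℤ from x) t = 0
    · refine hy t fun h' => ht ?_
      exact (congrArg₂ (· + ·) h h').trans (add_zero 0)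
    · exact hx t h
  neg_mem' {x} hx t ht := hx t fun h => ht ((congrArg Neg.neg h).trans neg_zero)

theorem smul_mem_supportedSubgroup {s : Set (T.obj (op (base F)))} {x : (freeModule T).component}
    (g : G) (hx : x ∈ supportedSubgroup s) :
    g • x ∈ supportedSubgroup (T.map (rightMul g).op '' s) := by
  classical
  intro t ht
  have h := Finsupp.mapDomain_support (f := T.map (rightMul g).op)
    (s := (show T.obj (op (base F)) →₀ ℤ from x)) (Finsupp.mem_support_iff.2 ht)
  obtain ⟨t', ht', rfl⟩ := Finset.mem_image.1 h
  exact ⟨t', hx t' (Finsupp.mem_support_iff.1 ht'), rfl⟩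

theorem IsLength.map_le_of_mem_supportedSubgroup {N : Type*} [AddCommGroup N] {ℓ : N → ℕ∞}
    (hℓ : IsLength ℓ) (r : (freeModule T).component →+ N) {C : ℕ∞}
    {s : Set (T.obj (op (base F)))} (hC : ∀ t ∈ s, ℓ (r (basisElt t)) ≤ C)
    {x : (freeModule T).component} (hx : x ∈ supportedSubgroup s) : ℓ (r x) ≤ C * freeNorm x := by
  let x' : T.obj (op (base F)) →₀ ℤ := x
  have h : r x = x'.sum fun t n => n • r (basisElt t) := by
    have : r = freeAddLift fun t => r (basisElt t) :=
      freeModule_addHom_ext fun t => (freeAddLift_basisElt (fun t => r (basisElt t)) t).symm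
    exact congrArg (fun k => k x) this
  rw [h]
  exact hℓ.sum_le x' _ C fun t ht => hC t (hx t (Finsupp.mem_support_iff.1 ht))

end FreeNorm

/-- An equivariant map on a free module is bounded on the image of a module that is finitely
generated over the subgroup. -/
theorem exists_bound_on_image {T : (OrbitCategory F)ᵒᵖ ⥤ Type u} (H : Subgroup G)
    {M : Type u} [AddCommGroup M] [DistribMulAction H M] {n : ℕ} {b : Fin n → M}
    (hb : Generates H b)
    (c : M →+ (freeModule T).component) (hc : ∀ (h : H) x, c (h • x) = (h : G) • c x)
    (r : (freeModule T).component →+ M) (hr : ∀ (h : H) x, r ((h : G) • x) = h • r x) :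
    ∃ C : ℕ, ∀ ν : M, fillingNorm H b (r (c ν)) ≤ C * freeNorm (c ν) := by
  -- The finitely many basis elements occurring in the images of the generators.
  let s : Set (T.obj (op (base F))) :=
    ⋃ i : Fin n, ((show T.obj (op (base F)) →₀ ℤ from c (b i)).support : Set _)
  have hs : s.Finite := Set.finite_iUnion fun i => Finset.finite_toSet _
  have hcs : ∀ i, c (b i) ∈ supportedSubgroup s := fun i t ht =>
    Set.mem_iUnion.2 ⟨i, Finsupp.mem_support_iff.2 ht⟩
  have := hs.to_subtype
  obtain ⟨C, hC⟩ := exists_nat_bound (fun t : s => fillingNorm H b (r (basisElt t.1)))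
    fun t => fillingNorm_ne_top hb _
  refine ⟨C, fun ν => ?_⟩
  -- The translates of `s` by `H` support the whole image of `c`. Since `r` is `H`-equivariant, the
  -- bound on `s` persists on them.
  let s' : Set (T.obj (op (base F))) := ⋃ h : H, T.map (rightMul (h : G)).op '' s
  refine (isLength_fillingNorm hb).map_le_of_mem_supportedSubgroup r (s := s') ?_ ?_
  · intro t' ht'
    obtain ⟨h, t, ht, rfl⟩ := Set.mem_iUnion.1 ht'
    have : (basisElt (T.map (rightMul (h : G)).op t) : (freeModule T).component) =
      (h : G) • (basisElt t : (freeModule T).component) := (map_basisElt _ t).symm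
    rw [this, hr]
    exact (fillingNorm_smul_le h _).trans (hC ⟨t, ht⟩)
  · obtain ⟨x, rfl⟩ := hb ν
    rw [freeMap_eq_sum, map_finsuppSum]
    refine sum_mem fun p _ => ?_
    dsimp only
    rw [map_zsmul, hc]
    refine zsmul_mem ?_ _
    intro t ht
    exact Set.mem_iUnion.2 ⟨p.2, smul_mem_supportedSubgroup _ (hcs p.1) t ht⟩

theorem exists_of_boundaryNorm_le (P : ProjectiveResolution (trivialZ F)) {n₂ : ℕ}
    {b₂ : Fin n₂ → resolutionComponent P 2} {γ : resolutionComponent P 1} {k : ℕ}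
    (h : boundaryNorm P b₂ γ ≤ k) :
    ∃ μ, resolutionBoundary P 1 μ = γ ∧ fillingNorm G b₂ μ ≤ k := by
  have h' : boundaryNorm P b₂ γ < (k + 1 : ℕ) := h.trans_lt (by exact_mod_cast Nat.lt_succ_self k)
  unfold boundaryNorm at h'
  simp only [iInf_lt_iff] at h'
  obtain ⟨μ, hμ, h⟩ := h'
  exact ⟨μ, hμ, (ENat.lt_add_one_iff (ENat.natCast_ne_top k)).1 (by exact_mod_cast h)⟩

/-- The filling function of a subgroup is bounded by the one of the group, if the group has
cohomological dimension at most two relative to the family. -/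
theorem growthLE_of_bredonCohomDimLE (hcd : BredonCohomDimLE F 2) (H : Subgroup G)
    {fH fG : ℕ → ℕ∞} (hfH : IsHomologicalFillingFunction (F.inter H) fH)
    (hfG : IsHomologicalFillingFunction F fG) : GrowthLE fH fG := by
  obtain ⟨P', hP'⟩ := hcd
  obtain ⟨Q, -, m₁, m₂, d₁, d₂, hd₁, hd₂, rfl⟩ := hfH
  obtain ⟨P, -, n₁, n₂, b₁, b₂, hb₁, hb₂, rfl⟩ := hfG
  obtain ⟨J, A, a, w, c, r, s, ha, hw, hc, hr, hs, hcycle, hfill⟩ :=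
    exists_comparison H Q P P' (hP' 3 (by norm_num))
  obtain ⟨C₁, hC₁⟩ := (isLength_fillingNorm hb₁).exists_bound fillingNorm_smul_le
    (fillingNorm_ne_top hb₁) (fun h : H => (h : G)) a ha d₁
  obtain ⟨C₂, hC₂⟩ := isLength_freeNorm.exists_bound freeNorm_smul_le freeNorm_ne_top
    (fun g : G => g) w hw b₂
  obtain ⟨C₃, hC₃⟩ := exists_bound_on_image H hd₂ c hc r hr
  obtain ⟨C₄, hC₄⟩ := (isLength_fillingNorm hd₂).exists_bound fillingNorm_smul_le
    (fillingNorm_ne_top hd₂) (fun h : H => h) s hs d₁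
  -- `C₁` rescales the argument, `C₃ * C₂` multiplies the filling, `C₄` is the linear error of the
  -- homotopy, and the `1` makes `C` positive.
  let C := C₃ * C₂ + C₁ + C₄ + 1
  refine ⟨C, Nat.succ_pos _, fun k => ?_⟩
  refine iSup_le fun γ => iSup₂_le fun hγ hγk => ?_
  have hle : boundaryNorm P b₂ (a γ) ≤ fillingFunction P b₁ b₂ (C * k + C) := by
    refine le_iSup_of_le (a γ) (le_iSup₂_of_le (hcycle γ hγ) ?_ le_rfl)
    refine (hC₁ γ k hγk).trans (Nat.cast_le.2 ?_)
    have : C₁ ≤ C := by simp only [C]; omega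
    nlinarith
  -- An infinite value makes the right-hand side infinite, as `C` is nonzero, so finiteness need not
  -- be proved.
  by_cases htop : boundaryNorm P b₂ (a γ) = ⊤
  · have : fillingFunction P b₁ b₂ (C * k + C) = ⊤ := top_le_iff.1 (htop ▸ hle)
    rw [this, ENat.mul_top (by simp [C]), top_add]
    exact le_top
  obtain ⟨m, hm⟩ := ENat.ne_top_iff_exists.1 htop
  obtain ⟨μ, hμ, hμm⟩ := exists_of_boundaryNorm_le P hm.ge
  -- No control on the size of `ν` is needed: it enters only through `c ν`, which equals `w μ`.
  obtain ⟨ν, hν⟩ := exists_resolutionBoundary_eq Q γ hγ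
  obtain ⟨hwc, hbd⟩ := hfill γ ν μ hγ hν hμ
  have hnorm : fillingNorm H d₂ (r (c ν) - s γ) ≤ ((C₃ * (C₂ * m) + C₄ * k : ℕ) : ℕ∞) := by
    have h₁ : fillingNorm H d₂ (r (c ν)) ≤ ((C₃ * (C₂ * m) : ℕ) : ℕ∞) := by
      refine (hC₃ ν).trans ?_
      rw [← hwc, Nat.cast_mul]
      gcongr
      exact hC₂ μ m hμm
    have hℓ := isLength_fillingNorm hd₂
    rw [sub_eq_add_neg, Nat.cast_add]
    exact (hℓ.add_le _ _).trans (add_le_add h₁ ((hℓ.neg_le _).trans (hC₄ γ k hγk)))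
  refine (iInf₂_le (r (c ν) - s γ) hbd).trans (hnorm.trans ?_)
  refine le_trans ?_ (add_le_add_left (mul_le_mul_right (hm.le.trans hle) _) _)
  rw [← Nat.cast_mul, ← Nat.cast_add, Nat.cast_le]
  have h₁ : C₃ * C₂ ≤ C := by simp only [C]; omega
  have h₂ : C₄ ≤ C := by simp only [C]; omega
  nlinarith [Nat.mul_le_mul_right m h₁, Nat.mul_le_mul_right k h₂]

end Subgroup

theorem theorem1p14 {G : Type u} [Group G] (F : SubgroupFamily G)
    (hmodel : HasCocompactModel F) (hcd : BredonCohomDimLE F 2)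
    (H : Subgroup G) (hH : IsTypeFP 2 (F.inter H)) :
    IsTypeFP 2 F ∧
      ∀ fH fG : ℕ → ℕ∞, IsHomologicalFillingFunction (F.inter H) fH →
        IsHomologicalFillingFunction F fG → GrowthLE fH fG :=
  ⟨hmodel.isTypeFP_two, fun _ _ hfH hfG => growthLE_of_bredonCohomDimLE hcd H hfH hfG⟩
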